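/- Let $X$ be a compact metric space with Borel $\sigma$-algebra $\mathcal B_X$, let $T:X\to X$ be a homeomorphism, and let $\mu$ be a $T$-invariant Borel probability measure on $X$; write $\mathcal B_\mu$ for the $\mu$-completion of $\mathcal B_X$ and $\mathcal E_T=\{E\in\mathcal B_X: T^{-1}E=E\}$. For partitions, $\alpha\prec\beta$ means that each atom of $\alpha$ is a union of atoms of $\beta$, $\alpha\vee\beta$ and $\bigvee_i\alpha_i$ denote common refinements, $\xi(x)$ is the atom of $\xi$ containing $x$, and $$T^k\alpha=\{T^kA:A\in\alpha\}\ (k\in\mathbb Z),\qquad \alpha_m^n=\bigvee_{k=m}^{n}T^{-k}\alpha,\qquad \alpha^-=\bigvee_{k=1}^\infty T^k\alpha .$$ A measurable partition is a partition of the form $\bigvee_{n\ge1}\alpha_n$ with finite Borel partitions $\alpha_n$. For such a partition $\xi$, let $\hat\xi$ be the $\sigma$-algebra of all sets that agree up to a $\mu$-null set with a set in $\mathcal B_\mu$ that is a union of atoms of $\xi$. For a finite Borel partition $\alpha$ and a sub-$\sigma$-algebra $\mathcal C\subset\mathcal B_\mu$ put $$I_\mu(\alpha|\mathcal C)=-\sum_{A\in\alpha}1_A\log\mathbb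 E_\mu(1_A|\mathcal C),\qquad H_\mu(\alpha|\mathcal C)=\int_X I_\mu(\alpha|\mathcal C)\,d\mu,\qquad I_\mu(\alpha|\xi)=I_\mu(\alpha|\hat\xi).$$ Let $\xi$ be a measurable partition with $T\xi\prec\xi$ and let $\alpha$ be a finite Borel partition with $\alpha^-\prec\xi$. Put $\gamma_n=\alpha^-\vee T^n\xi$ for $n\ge0$ and $\mathcal F=\bigcap_{n\ge0}\hat\gamma_n$. (1) The functions $I_\mu(\alpha_0^{N-1}|\xi)$ $(N\ge1)$ and $I_\mu(\alpha|\mathcal F)$ are $\mu$-integrable, and $$\lim_{N\to\infty}\frac1N I_\mu(\alpha_0^{N-1}|\xi)=\mathbb E_\mu\big(I_\mu(\alpha|\mathcal F)\,\big|\,\mathcal E_T\big)\qquad \mu\text{-a.e. and in }L^1(\mu).$$ (2) Suppose in addition that $\mu$ is ergodic, and let $(\mu_x)_{x\in X'}$ be a disintegration of $\mu$ over $\xi$, that is: $X'\in\mathcal B_X$ with $\mu(X')=1$, each $\mu_x$ $(x\in X')$ is a Borel probability measure on $X$, for every Borel $f\in L^1(\mu)$ one has $\mathbb E_\mu(f|\hat\xi)(x)=\int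 f\,d\mu_x$ for $\mu$-a.e. $x$, $\mu_x(X'\cap\xi(x))=1$ for every $x\in X'$, and $\mu_x=\mu_y$ whenever $x,y\in X'$ and $\xi(x)=\xi(y)$. Then there is a Borel set $X_0\subset X'$ with $\mu(X_0)=1$ such that for every $x\in X_0$ $$\mu_x(\xi(x)\cap X_0)=1\quad\text{and}\quad \lim_{N\to\infty}\frac{-\log\mu_x\big(\alpha_0^{N-1}(y)\big)}{N}=H_\mu(\alpha|\mathcal F)\quad\text{for every }y\in\xi(x)\cap X_0 .$$ -/

import Mathlib

open MeasureTheory Filter Topology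

namespace LocalSMB

/-! Partitions of `X` are encoded by their equivalence relations (`Setoid X`): the atoms of `α` are
the elements of `α.classes`, and the common refinement of a family of partitions is its infimum in
`Setoid X` (two points are equivalent iff they are equivalent for each member), so that the atoms of
the refinement are the nonempty intersections of atoms. -/

section Partitions

variable {X : Type*}

/-- The atom `ξ(x)` of the partition `ξ` that contains `x`. -/
def atom (ξ : Setoid X) (x : X) : Set X := {y | ξ y x}

theorem atom_mem_classes (ξ : Setoid X) (x : X) : atom ξ x ∈ ξ.classes := ⟨x, rfl⟩

/-- `α ≺ β`: each atom of `α` is a union of a collection of atoms of `β`. -/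
def Coarser (α β : Setoid X) : Prop :=
  ∀ A ∈ α.classes, ∃ S ⊆ β.classes, A = ⋃₀ S

theorem coarser_iff_le {α β : Setoid X} : Coarser α β ↔ β ≤ α := by
  constructor
  · intro h x y hxy
    obtain ⟨S, hS, hA⟩ := h _ (atom_mem_classes α y)
    have hy : y ∈ ⋃₀ S := hA ▸ (α.refl y : y ∈ atom α y)
    obtain ⟨B, hB, hyB⟩ := hy
    obtain ⟨z, rfl⟩ := hS hB
    have : x ∈ ⋃₀ S := ⟨_, hB, β.trans hxy hyB⟩
    rw [← hA] at this
    exact this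
  · rintro h _ ⟨x, rfl⟩
    refine ⟨{B | ∃ y, α y x ∧ B = atom β y}, ?_, ?_⟩
    · rintro _ ⟨y, -, rfl⟩
      exact atom_mem_classes β y
    · ext z
      constructor
      · intro hz
        exact ⟨_, ⟨z, hz, rfl⟩, β.refl z⟩
      · rintro ⟨_, ⟨y, hy, rfl⟩, hz⟩
        exact α.trans (h hz) hy

/-- A finite partition into measurable (Borel) sets. -/
def IsFinitePartition [MeasurableSpace X] (α : Setoid X) : Prop :=
  α.classes.Finite ∧ ∀ A ∈ α.classes, MeasurableSet A

/-- A measurable partition: the common refinement of a sequence of finite Borel partitions. -/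
def IsMeasurablePartition [MeasurableSpace X] (ξ : Setoid X) : Prop :=
  ∃ a : ℕ → Setoid X, (∀ n, IsFinitePartition (a n)) ∧ ξ = ⨅ n, a n

variable [TopologicalSpace X]

/-- The partition `T^k α = {T^k A : A ∈ α}`, for `k ∈ ℤ`: the points `x` and `y` are in the same
atom iff `T^{-k} x` and `T^{-k} y` are in the same atom of `α`. -/
def translate (T : X ≃ₜ X) (k : ℤ) (α : Setoid X) : Setoid X :=
  α.comap (T ^ (-k) : X ≃ₜ X)

/-- `α_m^n = ⋁_{m ≤ k ≤ n} T^{-k} α`. -/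
def window (T : X ≃ₜ X) (α : Setoid X) (m n : ℤ) : Setoid X :=
  ⨅ k ∈ Set.Icc m n, translate T (-k) α

/-- `α^- = ⋁_{k ≥ 1} T^k α`. -/
def past (T : X ≃ₜ X) (α : Setoid X) : Setoid X :=
  ⨅ k ∈ Set.Ici (1 : ℤ), translate T k α

/-- `γ_n = α^- ∨ T^n ξ`. -/
def gammaPart (T : X ≃ₜ X) (α ξ : Setoid X) (n : ℕ) : Setoid X :=
  past T α ⊓ translate T n ξ

end Partitions

section Measure

variable {X : Type*} [MeasurableSpace X]

/-- The completion `𝓑_μ` of the given `σ`-algebra with respect to `μ`, as a `σ`-algebra on `X`. -/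
@[reducible]
def completeAlgebra {X : Type*} [m0 : MeasurableSpace X] (μ : Measure X) : MeasurableSpace X :=
  eventuallyMeasurableSpace m0 (ae μ)

/-- The measure `μ` on its completed `σ`-algebra `𝓑_μ`. -/
noncomputable def completed {X : Type*} [MeasurableSpace X] (μ : Measure X) :
    @Measure X (completeAlgebra μ) :=
  μ.completion

theorem completed_apply {X : Type*} [MeasurableSpace X] (μ : Measure X) (A : Set X) :
    completed μ A = μ A :=
  Measure.completion_apply μ A

/-- The `σ`-algebra `{A ∈ 𝓑_μ : A = ⋃_{x ∈ A} ξ(x)}` of those sets in the `μ`-completion `𝓑_μ` of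
the given `σ`-algebra that are unions of atoms of `ξ`. -/
@[reducible]
def saturatedAlgebra (μ : Measure X) (ξ : Setoid X) : MeasurableSpace X where
  MeasurableSet' A := NullMeasurableSet A μ ∧ A = ⋃ x ∈ A, atom ξ x
  measurableSet_empty := ⟨MeasurableSet.empty.nullMeasurableSet, by simp⟩
  measurableSet_compl A hA := by
    refine ⟨hA.1.compl, Set.Subset.antisymm
      (fun x hx => Set.mem_iUnion₂.2 ⟨x, hx, ξ.refl x⟩) fun y hy => ?_⟩
    obtain ⟨x, hx, hyx⟩ := Set.mem_iUnion₂.1 hy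
    intro hyA
    apply hx
    rw [hA.2]
    exact Set.mem_iUnion₂.2 ⟨y, hyA, ξ.symm hyx⟩
  measurableSet_iUnion f hf := by
    refine ⟨NullMeasurableSet.iUnion fun i => (hf i).1, Set.Subset.antisymm
      (fun x hx => Set.mem_iUnion₂.2 ⟨x, hx, ξ.refl x⟩) fun y hy => ?_⟩
    obtain ⟨x, hx, hyx⟩ := Set.mem_iUnion₂.1 hy
    obtain ⟨i, hi⟩ := Set.mem_iUnion.1 hx
    refine Set.mem_iUnion.2 ⟨i, ?_⟩
    rw [(hf i).2]
    exact Set.mem_iUnion₂.2 ⟨x, hi, hyx⟩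

/-- The `μ`-complete `σ`-algebra `ξ̂` associated with the partition `ξ`: all sets that agree up to a
`μ`-null set with a set in `𝓑_μ` that is a union of atoms of `ξ`. -/
@[reducible]
def hat (μ : Measure X) (ξ : Setoid X) : MeasurableSpace X :=
  eventuallyMeasurableSpace (saturatedAlgebra μ ξ) (ae μ)

/-- The conditional expectation `𝔼_μ(f | 𝓒)` for a sub-`σ`-algebra `𝓒` of the completion `𝓑_μ`,
taken in the complete probability space `(X, 𝓑_μ, μ)`. -/
noncomputable def condE {X : Type*} {m0 : MeasurableSpace X} (μ : Measure X)
    (C : MeasurableSpace X) (f : X → ℝ) : X → ℝ :=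
  @condExp X ℝ C (@completeAlgebra X m0 μ) _ _ (@completed X m0 μ) f

/-- The conditional information function
`I_μ(α | 𝓒)(x) = - ∑_{A ∈ α} 1_A(x) log 𝔼_μ(1_A | 𝓒)(x)` of a finite partition `α`. -/
noncomputable def info {X : Type*} {m0 : MeasurableSpace X} (μ : Measure X) (α : Setoid X)
    (C : MeasurableSpace X) (x : X) : ℝ :=
  -∑ᶠ A ∈ α.classes, A.indicator 1 x * Real.log (@condE X m0 μ C (A.indicator 1) x)

/-- The conditional entropy `H_μ(α | 𝓒) = ∫ I_μ(α | 𝓒) dμ`. -/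
noncomputable def condEntropy {X : Type*} {m0 : MeasurableSpace X} (μ : Measure X) (α : Setoid X)
    (C : MeasurableSpace X) : ℝ :=
  @integral X ℝ _ _ m0 μ (@info X m0 μ α C)

/-- The family `(κ x)_{x ∈ X'}` is a disintegration of `μ` over the partition `ξ`. (The values
`κ x` for `x ∉ X'` are irrelevant.) -/
structure IsDisintegration (μ : Measure X) (ξ : Setoid X) (X' : Set X) (κ : X → Measure X) :
    Prop where
  measurableSet : MeasurableSet X'
  measure_eq_one : μ X' = 1
  isProbabilityMeasure : ∀ x ∈ X', IsProbabilityMeasure (κ x)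
  condE_eq : ∀ f : X → ℝ, Measurable f → Integrable f μ →
    ∀ᵐ x ∂μ, condE μ (hat μ ξ) f x = ∫ y, f y ∂(κ x)
  measure_atom : ∀ x ∈ X', κ x (X' ∩ atom ξ x) = 1
  eq_of_atom_eq : ∀ x ∈ X', ∀ y ∈ X', atom ξ x = atom ξ y → κ x = κ y

/-- `𝓕 = ⋂_{n ≥ 0} γ̂_n` with `γ_n = α^- ∨ T^n ξ`. -/
@[reducible]
def tailAlgebra [TopologicalSpace X] (μ : Measure X) (T : X ≃ₜ X) (α ξ : Setoid X) :
    MeasurableSpace X :=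
  ⨅ n : ℕ, hat μ (gammaPart T α ξ n)

end Measure

end LocalSMB

/-!
The theorem is Breiman's proof of the Shannon–McMillan–Breiman theorem, run with a decreasing
sequence of `σ`-algebras.

Since `α⁻ ≺ ξ`, the map `T^k` carries `ξ ∨ α_0^{k-1}` to `γ_k = α⁻ ∨ T^k ξ`
(`inf_window_eq_comap_gammaPart`), and the chain rule for information gives
`I(α_0^{N-1} | ξ) = ∑_{k < N} I(α | γ_k) ∘ T^k` (`condInfo_window_ae_eq_sum`). As `T ξ ≺ ξ`, the
`σ`-algebras of the `γ_k` decrease, so reverse martingale convergence (`ae_tendsto_condExp_iInf`)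
yields `I(α | γ_k) → I(α | 𝓕)` almost everywhere, and the Chung–Neveu lemma
(`exists_integrable_neg_log_condExp_le`) dominates the whole sequence by an integrable function.
Breiman's extension of Birkhoff's theorem (`ae_tendsto_average_comp_iterate`) then gives the almost
everywhere limit; the functions being nonnegative, Scheffé's lemma
(`tendsto_eLpNorm_one_of_nonneg`) gives the limit in `L¹`.

The chain rule needs that the `σ`-algebras attached to `ξ` and to `ξ ∨ β` have the same trace on an
atom of a finite partition `β`, up to null sets. These `σ`-algebras consist of all measurable
saturated sets, not of the sets generated by a countable family, so this is not formal: it is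
Lusin's separation theorem for analytic sets (`exists_measurableSet_hat_trace`).

Conditional expectations on the completion are replaced throughout by conditional expectations
relative to the Borel sets of the given `σ`-algebra (`condE_ae_eq_condExp_inf`).

For the ergodic case, the conditional probability of an atom of `α_0^{N-1}` is its measure under
the disintegration, and a set of full measure on which the limit holds is shrunk to a Borel set
which has full conditional measure in each of its atoms
(`IsDisintegration.exists_measurableSet_full`).
-/

namespace LocalSMB

/-! ### The pointwise ergodic theorem and Breiman's extension -/

section ErgodicTheorem

variable {Ω : Type*} {T : Ω → Ω}

/-- The running maximum `max_{0 ≤ k ≤ n} ∑_{j < k} f ∘ T^j` of the Birkhoff sums, given by the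
recursion `F_{n+1} = max 0 (f + F_n ∘ T)`. -/
noncomputable def birkhoffMax (T : Ω → Ω) (f : Ω → ℝ) : ℕ → Ω → ℝ
  | 0 => 0
  | n + 1 => fun x => max 0 (f x + birkhoffMax T f n (T x))

theorem birkhoffMax_nonneg (f : Ω → ℝ) (n : ℕ) (x : Ω) : 0 ≤ birkhoffMax T f n x := by
  cases n with
  | zero => exact le_rfl
  | succ n => exact le_max_left _ _

theorem birkhoffMax_le_succ (f : Ω → ℝ) (n : ℕ) (x : Ω) :
    birkhoffMax T f n x ≤ birkhoffMax T f (n + 1) x := by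
  induction n generalizing x with
  | zero => exact birkhoffMax_nonneg f 1 x
  | succ n ih => exact max_le_max le_rfl (by gcongr; exact ih _)

theorem birkhoffSum_le_birkhoffMax (f : Ω → ℝ) (n : ℕ) (x : Ω) :
    birkhoffSum T f n x ≤ birkhoffMax T f n x := by
  induction n generalizing x with
  | zero => simp [birkhoffMax]
  | succ n ih =>
    rw [birkhoffSum_succ']
    exact (by gcongr; exact ih _ : _ ≤ _).trans (le_max_right _ _)

theorem bddAbove_birkhoffMax_comp_iff (f : Ω → ℝ) (x : Ω) :
    BddAbove (Set.range fun n => birkhoffMax T f n (T x)) ↔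
      BddAbove (Set.range fun n => birkhoffMax T f n x) := by
  constructor
  · rintro ⟨M, hM⟩
    refine ⟨max 0 (f x + M), ?_⟩
    rintro _ ⟨n, rfl⟩
    exact (birkhoffMax_le_succ f n x).trans
      (max_le_max le_rfl (by gcongr; exact hM ⟨n, rfl⟩))
  · rintro ⟨M, hM⟩
    refine ⟨M - f x, ?_⟩
    rintro _ ⟨n, rfl⟩
    have h1 : birkhoffMax T f (n + 1) x ≤ M := hM ⟨n + 1, rfl⟩
    have h2 : f x + birkhoffMax T f n (T x) ≤ birkhoffMax T f (n + 1) x := le_max_right _ _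
    simp only
    linarith

variable [MeasurableSpace Ω] {μ : Measure Ω}

theorem measurable_birkhoffMax (hT : Measurable T) {f : Ω → ℝ} (hf : Measurable f) (n : ℕ) :
    Measurable (birkhoffMax T f n) := by
  induction n with
  | zero => exact measurable_const
  | succ n ih => exact measurable_const.max (hf.add (ih.comp hT))

theorem integrable_birkhoffMax (hT : MeasurePreserving T μ μ) {f : Ω → ℝ} (hfi : Integrable f μ)
    (n : ℕ) : Integrable (birkhoffMax T f n) μ := by
  induction n with
  | zero => exact integrable_zero _ _ _
  | succ n ih =>
    exact (integrable_zero _ _ _).sup (hfi.add (hT.integrable_comp_of_integrable ih))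

/-- The core of the pointwise ergodic theorem: on the invariant set `A` where the running maxima
`F_n` are unbounded, `F_{n+1} - F_n ∘ T` decreases to `f`, so that `∫_A f` is a limit of
`∫_A (F_{n+1} - F_n) ≥ 0`; if `f` has negative conditional mean, this forces `μ A = 0`. -/
theorem ae_bddAbove_birkhoffSum [IsFiniteMeasure μ] (hT : MeasurePreserving T μ μ) {f : Ω → ℝ}
    (hf : Measurable f) (hfi : Integrable f μ)
    (hneg : ∀ᵐ x ∂μ, (μ[f | MeasurableSpace.invariants T]) x < 0) :
    ∀ᵐ x ∂μ, BddAbove (Set.range fun n => birkhoffSum T f n x) := by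
  have hm := MeasurableSpace.invariants_le T
  set A : Set Ω := {x | BddAbove (Set.range fun n => birkhoffMax T f n x)}ᶜ with hA
  have hAm : MeasurableSet A :=
    (measurableSet_bddAbove_range fun n => measurable_birkhoffMax hT.measurable hf n).compl
  have hAinv : T ⁻¹' A = A := by
    ext x
    exact not_congr (bddAbove_birkhoffMax_comp_iff f x)
  have hint := integrable_birkhoffMax hT hfi
  have hintT : ∀ n, Integrable (fun x => birkhoffMax T f n (T x)) μ := fun n =>
    hT.integrable_comp_of_integrable (hint n)
  have hlim : Tendsto (fun n => ∫ x in A, (birkhoffMax T f (n + 1) x - birkhoffMax T f n (T x)) ∂μ)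
      atTop (𝓝 (∫ x in A, f x ∂μ)) := by
    refine tendsto_integral_of_dominated_convergence (fun x => |f x|)
      (fun n => ((hint (n + 1)).sub (hintT n)).aestronglyMeasurable.restrict)
      hfi.abs.integrableOn (fun n => ae_of_all _ fun x => ?_) ?_
    · have h0 := birkhoffMax_nonneg (T := T) f n (T x)
      simp only [birkhoffMax, Real.norm_eq_abs]
      rcases max_cases 0 (f x + birkhoffMax T f n (T x)) with h | h <;> rw [h.1]
      · rw [abs_le]
        constructor <;> linarith [neg_abs_le (f x), abs_nonneg (f x)]
      · simp
    · refine (ae_restrict_iff' hAm).2 (ae_of_all _ fun x hx => ?_)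
      have hx' : ¬ BddAbove (Set.range fun n => birkhoffMax T f n (T x)) := by
        rw [bddAbove_birkhoffMax_comp_iff]
        exact hx
      obtain ⟨n₀, hn₀⟩ : ∃ n, -f x < birkhoffMax T f n (T x) := by
        by_contra! h
        exact hx' ⟨-f x, by rintro _ ⟨n, rfl⟩; exact h n⟩
      refine tendsto_const_nhds.congr' ?_
      filter_upwards [eventually_ge_atTop n₀] with n hn
      have h1 : birkhoffMax T f n₀ (T x) ≤ birkhoffMax T f n (T x) :=
        monotone_nat_of_le_succ (fun n => birkhoffMax_le_succ f n (T x)) hn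
      simp only [birkhoffMax]
      rw [max_eq_right (by linarith)]
      ring
  have hpos : 0 ≤ ∫ x in A, f x ∂μ := by
    refine ge_of_tendsto' hlim fun n => ?_
    have h1 : ∫ x in A, birkhoffMax T f n (T x) ∂μ = ∫ x in A, birkhoffMax T f n x ∂μ := by
      conv_rhs => rw [← hT.map_eq]
      rw [setIntegral_map hAm (by rw [hT.map_eq]; exact (hint n).aestronglyMeasurable)
        hT.measurable.aemeasurable, hAinv]
    rw [integral_sub (hint (n + 1)).integrableOn (hintT n).integrableOn]
    rw [h1, ← integral_sub (hint (n + 1)).integrableOn (hint n).integrableOn]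
    exact integral_nonneg fun x => sub_nonneg.2 (birkhoffMax_le_succ f n x)
  rw [← setIntegral_condExp hm hfi (s := A) ⟨hAm, hAinv⟩] at hpos
  have hzero : μ A = 0 := by
    by_contra hne
    have h1 : 0 < ∫ x in A, -(μ[f | MeasurableSpace.invariants T]) x ∂μ := by
      rw [integral_pos_iff_support_of_nonneg_ae]
      · have : (Function.support fun x => -(μ[f | MeasurableSpace.invariants T]) x)
            =ᵐ[μ.restrict A] (Set.univ : Set Ω) := by
          refine eventuallyEq_set.2 ?_
          filter_upwards [ae_restrict_of_ae hneg] with x hx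
          simp [hx.ne]
        rw [measure_congr this]
        simpa using pos_iff_ne_zero.2 hne
      · filter_upwards [ae_restrict_of_ae hneg] with x hx
        simpa using hx.le
      · exact integrable_condExp.neg.integrableOn
    rw [integral_neg] at h1
    linarith
  have : ∀ᵐ x ∂μ, x ∉ A := measure_eq_zero_iff_ae_notMem.1 hzero
  filter_upwards [this] with x hx
  obtain ⟨M, hM⟩ := not_not.1 hx
  refine ⟨M, ?_⟩
  rintro _ ⟨n, rfl⟩
  exact (birkhoffSum_le_birkhoffMax f n x).trans (hM ⟨n, rfl⟩)

theorem condExp_invariants_comp (f : Ω → ℝ) :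
    (μ[f | MeasurableSpace.invariants T]) ∘ T = μ[f | MeasurableSpace.invariants T] :=
  MeasurableSpace.comp_eq_of_measurable_invariants stronglyMeasurable_condExp.measurable

theorem ae_eventually_birkhoffSum_le [IsFiniteMeasure μ] (hT : MeasurePreserving T μ μ)
    {f : Ω → ℝ} (hf : Measurable f) (hfi : Integrable f μ) {ε : ℝ} (hε : 0 < ε) :
    ∀ᵐ x ∂μ, ∀ᶠ n : ℕ in atTop, (1 / (n : ℝ)) * birkhoffSum T f n x ≤
      (μ[f | MeasurableSpace.invariants T]) x + ε := by
  have hm := MeasurableSpace.invariants_le T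
  set E := μ[f | MeasurableSpace.invariants T] with hE
  have hEs : StronglyMeasurable[MeasurableSpace.invariants T] E := stronglyMeasurable_condExp
  have hc : StronglyMeasurable[MeasurableSpace.invariants T] (fun x => E x + ε / 2) :=
    hEs.add stronglyMeasurable_const
  have hci : Integrable (fun x => E x + ε / 2) μ := integrable_condExp.add (integrable_const _)
  have hg : ∀ᵐ x ∂μ, (μ[f - (fun x => E x + ε / 2) | MeasurableSpace.invariants T]) x < 0 := by
    filter_upwards [condExp_sub hfi hci (MeasurableSpace.invariants T)] with x hx
    rw [hx, Pi.sub_apply, condExp_of_stronglyMeasurable hm hc hci]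
    simp only [← hE]
    linarith
  filter_upwards [ae_bddAbove_birkhoffSum hT (hf.sub (hc.measurable.mono hm le_rfl))
    (hfi.sub hci) hg] with x hx
  obtain ⟨M, hM⟩ := hx
  have hlim : Tendsto (fun n : ℕ => M / (n : ℝ)) atTop (𝓝 0) :=
    tendsto_const_div_atTop_nhds_zero_nat M
  filter_upwards [hlim.eventually (gt_mem_nhds (half_pos hε)), eventually_gt_atTop 0] with n hn hn0
  have hn0' : (0 : ℝ) < n := by exact_mod_cast hn0
  have h1 : birkhoffSum T f n x - (n * E x + n * (ε / 2)) ≤ M := by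
    have := hM ⟨n, rfl⟩
    have hinv : (fun x => E x + ε / 2) ∘ T = fun x => E x + ε / 2 := by
      ext y
      have := congrFun (condExp_invariants_comp (μ := μ) (T := T) f) y
      simpa using this
    simp only [birkhoffSum_sub, birkhoffSum_of_comp_eq hinv] at this
    simpa using this
  rw [one_div, inv_mul_le_iff₀ hn0']
  rw [div_lt_iff₀ hn0'] at hn
  nlinarith

/-- **Pointwise ergodic theorem** (Birkhoff). -/
theorem ae_tendsto_birkhoffSum [IsFiniteMeasure μ] (hT : MeasurePreserving T μ μ)
    {f : Ω → ℝ} (hfi : Integrable f μ) :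
    ∀ᵐ x ∂μ, Tendsto (fun n : ℕ => (1 / (n : ℝ)) * birkhoffSum T f n x) atTop
      (𝓝 ((μ[f | MeasurableSpace.invariants T]) x)) := by
  wlog hf : Measurable f generalizing f
  · have hae : f =ᵐ[μ] hfi.aestronglyMeasurable.mk f := hfi.aestronglyMeasurable.ae_eq_mk
    filter_upwards [this (hfi.congr hae) hfi.aestronglyMeasurable.stronglyMeasurable_mk.measurable,
      condExp_congr_ae (m := MeasurableSpace.invariants T) hae,
      ae_all_iff.2 fun n => hT.quasiMeasurePreserving.birkhoffSum_ae_eq_of_ae_eq hae n]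
      with x hx h1 h2
    simpa only [h1, h2] using hx
  have h1 : ∀ᵐ x ∂μ, ∀ k : ℕ, ∀ᶠ n : ℕ in atTop, (1 / (n : ℝ)) * birkhoffSum T f n x ≤
      (μ[f | MeasurableSpace.invariants T]) x + 1 / ((k : ℝ) + 1) :=
    ae_all_iff.2 fun k => ae_eventually_birkhoffSum_le hT hf hfi Nat.one_div_pos_of_nat
  have h2 : ∀ᵐ x ∂μ, ∀ k : ℕ, ∀ᶠ n : ℕ in atTop, (1 / (n : ℝ)) * birkhoffSum T (-f) n x ≤
      (μ[-f | MeasurableSpace.invariants T]) x + 1 / ((k : ℝ) + 1) :=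
    ae_all_iff.2 fun k => ae_eventually_birkhoffSum_le hT hf.neg hfi.neg Nat.one_div_pos_of_nat
  filter_upwards [h1, h2, condExp_neg f (MeasurableSpace.invariants T)] with x h1 h2 h3
  rw [Metric.tendsto_nhds]
  intro ε hε
  obtain ⟨k, hk⟩ := exists_nat_one_div_lt hε
  filter_upwards [h1 k, h2 k] with n hn1 hn2
  rw [h3, birkhoffSum_neg] at hn2
  rw [Real.dist_eq, abs_lt]
  simp only [Pi.neg_apply] at hn2
  constructor <;> linarith

/-- An average of `a` tends to `0` if `|a|` is eventually dominated by sequences whose averages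
have arbitrarily small limits. -/
theorem tendsto_average_zero_of_dominated {a : ℕ → ℝ} {b : ℕ → ℕ → ℝ} {L : ℕ → ℝ}
    (hb : ∀ m k, 0 ≤ b m k) (hab : ∀ m k, m ≤ k → |a k| ≤ b m k)
    (hL : ∀ m, Tendsto (fun N : ℕ => (1 / (N : ℝ)) * ∑ k ∈ Finset.range N, b m k) atTop (𝓝 (L m)))
    (hinf : ∀ ε > 0, ∃ m, L m < ε) :
    Tendsto (fun N : ℕ => (1 / (N : ℝ)) * ∑ k ∈ Finset.range N, a k) atTop (𝓝 0) := by
  rw [Metric.tendsto_nhds]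
  intro ε hε
  obtain ⟨m, hm⟩ := hinf (ε / 2) (half_pos hε)
  set C := ∑ k ∈ Finset.range m, |a k| with hC
  have hlim : Tendsto (fun n : ℕ => C / (n : ℝ)) atTop (𝓝 0) :=
    tendsto_const_div_atTop_nhds_zero_nat C
  filter_upwards [(hL m).eventually (gt_mem_nhds hm), hlim.eventually (gt_mem_nhds (half_pos hε)),
    eventually_ge_atTop m] with N h1 h2 h3
  have h4 : ∑ k ∈ Finset.range N, |a k| ≤ C + ∑ k ∈ Finset.range N, b m k := by
    rw [← Finset.sum_range_add_sum_Ico _ h3, ← Finset.sum_range_add_sum_Ico (b m) h3]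
    have h5 : ∑ k ∈ Finset.Ico m N, |a k| ≤ ∑ k ∈ Finset.Ico m N, b m k :=
      Finset.sum_le_sum fun k hk => hab m k (Finset.mem_Ico.1 hk).1
    have h6 : 0 ≤ ∑ k ∈ Finset.range m, b m k := Finset.sum_nonneg fun k _ => hb m k
    linarith
  rw [dist_zero_right, Real.norm_eq_abs, abs_mul, abs_of_nonneg (by positivity)]
  calc (1 / (N : ℝ)) * |∑ k ∈ Finset.range N, a k|
      ≤ (1 / (N : ℝ)) * (C + ∑ k ∈ Finset.range N, b m k) := by
        gcongr
        exact (Finset.abs_sum_le_sum_abs _ _).trans h4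
    _ = C / N + (1 / (N : ℝ)) * ∑ k ∈ Finset.range N, b m k := by ring
    _ < ε := by linarith

/-- Breiman's form of the ergodic theorem (also due to Maker): along a dominated, almost everywhere
convergent sequence `g k`, the averages of `g k ∘ T^k` behave as those of the limit. -/
theorem ae_tendsto_average_comp_iterate [IsFiniteMeasure μ] (hT : MeasurePreserving T μ μ)
    {g : ℕ → Ω → ℝ} {g' G : Ω → ℝ} (hg : ∀ k, AEStronglyMeasurable (g k) μ)
    (hG : Integrable G μ) (hbd : ∀ k, ∀ᵐ x ∂μ, |g k x| ≤ G x)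
    (hlim : ∀ᵐ x ∂μ, Tendsto (fun k => g k x) atTop (𝓝 (g' x))) :
    ∀ᵐ x ∂μ, Tendsto
      (fun N : ℕ => (1 / (N : ℝ)) * ∑ k ∈ Finset.range N, g k (T^[k] x)) atTop
      (𝓝 ((μ[g' | MeasurableSpace.invariants T]) x)) := by
  have hm := MeasurableSpace.invariants_le T
  have hg' : AEStronglyMeasurable g' μ := aestronglyMeasurable_of_tendsto_ae atTop hg hlim
  have hgood : ∀ᵐ x ∂μ, (∀ k, |g k x - g' x| ≤ 2 * G x) ∧ |g' x| ≤ G x ∧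
      Tendsto (fun k => g k x) atTop (𝓝 (g' x)) := by
    filter_upwards [ae_all_iff.2 hbd, hlim] with x h1 h2
    have h3 : |g' x| ≤ G x := le_of_tendsto' h2.abs h1
    exact ⟨fun k => (abs_sub _ _).trans (by linarith [h1 k]), h3, h2⟩
  have hgi : Integrable g' μ := hG.mono' hg' (by filter_upwards [hgood] with x hx using hx.2.1)
  -- `h m` is the tail supremum of the deviations from the limit
  set h : ℕ → Ω → ℝ := fun m x => ⨆ k, |g (m + k) x - g' x| with hh
  have hpt : ∀ x, (∀ k, |g k x - g' x| ≤ 2 * G x) → ∀ m k, m ≤ k → |g k x - g' x| ≤ h m x := by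
    intro x hx m k hmk
    obtain ⟨j, rfl⟩ := Nat.exists_eq_add_of_le hmk
    exact le_ciSup (f := fun k => |g (m + k) x - g' x|)
      ⟨2 * G x, by rintro _ ⟨i, rfl⟩; exact hx _⟩ j
  have hnn : ∀ m x, 0 ≤ h m x := fun m x => Real.iSup_nonneg fun k => abs_nonneg _
  have hle : ∀ x, (∀ k, |g k x - g' x| ≤ 2 * G x) → ∀ m, h m x ≤ 2 * G x :=
    fun x hx m => ciSup_le fun k => hx _
  have hmeas : ∀ m, AEStronglyMeasurable (h m) μ := fun m =>
    (AEMeasurable.iSup fun k =>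
      ((hg (m + k)).sub hg').norm.aemeasurable).aestronglyMeasurable
  have hbound : ∀ m, ∀ᵐ x ∂μ, ‖h m x‖ ≤ 2 * G x := fun m => by
    filter_upwards [hgood] with x hx
    rw [Real.norm_of_nonneg (hnn m x)]
    exact hle x hx.1 m
  have hhi : ∀ m, Integrable (h m) μ := fun m => (hG.const_mul 2).mono' (hmeas m) (hbound m)
  have hh0 : Tendsto (fun m => ∫ x, h m x ∂μ) atTop (𝓝 0) := by
    have := tendsto_integral_of_dominated_convergence (F := h) (f := fun _ => (0 : ℝ))
      (fun x => 2 * G x) hmeas (hG.const_mul 2) hbound ?_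
    · simpa using this
    · filter_upwards [hgood] with x hx
      rw [Metric.tendsto_atTop]
      intro ε hε
      obtain ⟨n, hn⟩ := Metric.tendsto_atTop.1 hx.2.2 (ε / 2) (half_pos hε)
      refine ⟨n, fun m hm => ?_⟩
      rw [dist_zero_right, Real.norm_of_nonneg (hnn m x)]
      refine lt_of_le_of_lt (ciSup_le fun k => ?_) (half_lt_self hε)
      exact (hn (m + k) (by omega)).le
  have hE0 : ∀ᵐ x ∂μ, ∀ ε > 0, ∃ m, (μ[h m | MeasurableSpace.invariants T]) x < ε := by
    have hEm : ∀ m, Measurable fun x =>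
        ENNReal.ofReal ((μ[h m | MeasurableSpace.invariants T]) x) := fun m =>
      (stronglyMeasurable_condExp.mono hm).measurable.ennreal_ofReal
    have hz : ∫⁻ x, ⨅ m, ENNReal.ofReal ((μ[h m | MeasurableSpace.invariants T]) x) ∂μ = 0 := by
      refine le_antisymm ?_ zero_le
      have h1 : Tendsto (fun m => ENNReal.ofReal (∫ x, h m x ∂μ)) atTop (𝓝 0) := by
        simpa using ENNReal.tendsto_ofReal hh0
      refine ge_of_tendsto' h1 fun m => ?_
      rw [← integral_condExp hm, ofReal_integral_eq_lintegral_ofReal integrable_condExp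
        (condExp_nonneg (ae_of_all _ (hnn m)))]
      exact lintegral_mono fun x => iInf_le _ m
    rw [lintegral_eq_zero_iff (Measurable.iInf hEm)] at hz
    filter_upwards [hz] with x hx ε hε
    have : ⨅ m, ENNReal.ofReal ((μ[h m | MeasurableSpace.invariants T]) x) < ENNReal.ofReal ε := by
      rw [hx]
      simpa using hε
    obtain ⟨m, hm'⟩ := iInf_lt_iff.1 this
    exact ⟨m, (ENNReal.ofReal_lt_ofReal_iff hε).1 hm'⟩
  have horb : ∀ᵐ x ∂μ, ∀ j : ℕ, ∀ k, |g k (T^[j] x) - g' (T^[j] x)| ≤ 2 * G (T^[j] x) := by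
    refine ae_all_iff.2 fun j => ?_
    filter_upwards [(hT.iterate j).quasiMeasurePreserving.ae hgood] with x hx using hx.1
  filter_upwards [hE0, horb, ae_tendsto_birkhoffSum hT hgi,
    ae_all_iff.2 fun m => ae_tendsto_birkhoffSum hT (hhi m)] with x h1 h2 h3 h4
  have := tendsto_average_zero_of_dominated (a := fun k => g k (T^[k] x) - g' (T^[k] x))
    (b := fun m k => h m (T^[k] x)) (fun m k => hnn m _)
    (fun m k hmk => hpt _ (h2 k) m k hmk) h4 h1
  have h5 := this.add h3
  rw [zero_add] at h5
  refine h5.congr fun N => ?_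
  rw [← mul_add, birkhoffSum, ← Finset.sum_add_distrib]
  simp

/-- Scheffé's lemma: for nonnegative functions, almost everywhere convergence together with
convergence of the integrals gives convergence in `L¹`. -/
theorem tendsto_eLpNorm_one_of_nonneg {f : ℕ → Ω → ℝ} {g : Ω → ℝ}
    (hf : ∀ n, Integrable (f n) μ) (hg : Integrable g μ) (hf0 : ∀ n, 0 ≤ᵐ[μ] f n)
    (hlim : ∀ᵐ x ∂μ, Tendsto (fun n => f n x) atTop (𝓝 (g x)))
    (hint : Tendsto (fun n => ∫ x, f n x ∂μ) atTop (𝓝 (∫ x, g x ∂μ))) :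
    Tendsto (fun n => eLpNorm (fun x => f n x - g x) 1 μ) atTop (𝓝 0) := by
  have hg0 : 0 ≤ᵐ[μ] g := by
    filter_upwards [hlim, ae_all_iff.2 hf0] with x h1 h2 using ge_of_tendsto' h1 h2
  have hsub : ∀ n, Integrable (fun x => f n x - g x) μ := fun n => (hf n).sub hg
  have hpart : ∀ n, Integrable (fun x => max (g x - f n x) 0) μ := fun n =>
    (hg.sub (hf n)).pos_part
  have hpos : Tendsto (fun n => ∫ x, max (g x - f n x) 0 ∂μ) atTop (𝓝 0) := by
    have := tendsto_integral_of_dominated_convergence (F := fun n x => max (g x - f n x) 0)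
      (f := fun _ => (0 : ℝ)) (μ := μ) g (fun n => (hpart n).aestronglyMeasurable)
      hg (fun n => ?_) ?_
    · simpa using this
    · filter_upwards [hf0 n, hg0] with x h1 h2
      simp only [Pi.zero_apply] at h1 h2
      rw [Real.norm_of_nonneg (le_max_right _ _)]
      exact max_le (by linarith) h2
    · filter_upwards [hlim] with x hx
      have := (tendsto_const_nhds (x := g x)).sub hx
      simpa using this.max (tendsto_const_nhds (x := (0 : ℝ)))
  have habs : Tendsto (fun n => ∫ x, |f n x - g x| ∂μ) atTop (𝓝 0) := by
    have h1 : ∀ n, ∫ x, |f n x - g x| ∂μ =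
        (∫ x, f n x ∂μ - ∫ x, g x ∂μ) + 2 * ∫ x, max (g x - f n x) 0 ∂μ := by
      intro n
      rw [← integral_sub (hf n) hg, ← integral_const_mul,
        ← integral_add (hsub n) ((hpart n).const_mul 2)]
      congr 1
      ext x
      rcases le_total (g x - f n x) 0 with h | h
      · rw [max_eq_right h, abs_of_nonneg (by linarith)]; ring
      · rw [max_eq_left h, abs_of_nonpos (by linarith)]; ring
    simp_rw [h1]
    simpa using (hint.sub_const (∫ x, g x ∂μ)).add (hpos.const_mul 2)
  have h2 : ∀ n, eLpNorm (fun x => f n x - g x) 1 μ = ENNReal.ofReal (∫ x, |f n x - g x| ∂μ) := by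
    intro n
    rw [eLpNorm_one_eq_lintegral_enorm, ofReal_integral_eq_lintegral_ofReal
      (hsub n).abs (ae_of_all _ fun x => abs_nonneg _)]
    simp [Real.enorm_eq_ofReal_abs]
  simp_rw [h2]
  simpa using ENNReal.tendsto_ofReal habs

end ErgodicTheorem

/-! ### Reverse martingales and the Chung–Neveu lemma -/

section ReverseMartingale

variable {Ω : Type*} {m0 : MeasurableSpace Ω} {μ : Measure Ω}

/-- The maximal inequality for reverse martingales. The `σ`-algebras decrease, so a point of the
union is assigned to the last `U k` containing it. -/
theorem mul_measureReal_iUnion_le_setIntegral [IsFiniteMeasure μ] {f : Ω → ℝ}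
    (hf : Integrable f μ) (c : ℝ) (N : ℕ) (C : ℕ → MeasurableSpace Ω) (hC : Antitone C)
    (hCm : ∀ k, C k ≤ m0) (U : ℕ → Set Ω) (hU : ∀ k, MeasurableSet[C k] (U k))
    (hc : ∀ k, ∀ᵐ x ∂μ, x ∈ U k → c ≤ (μ[f | C k]) x) :
    c * μ.real (⋃ k < N, U k) ≤ ∫ x in ⋃ k < N, U k, f x ∂μ := by
  induction N generalizing C U with
  | zero => simp
  | succ N ih =>
    set V := ⋃ k < N, U (k + 1) with hV
    have hVm : MeasurableSet[C 0] V :=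
      MeasurableSet.iUnion fun k => MeasurableSet.iUnion fun _ => hC (Nat.zero_le _) _ (hU (k + 1))
    have hWm : MeasurableSet[C 0] (U 0 \ V) := (hU 0).diff hVm
    have hsplit : (⋃ k < N + 1, U k) = V ∪ (U 0 \ V) := by
      rw [Set.union_sdiff_self, Set.biUnion_lt_succ', Set.union_comm]
    have hdisj : Disjoint V (U 0 \ V) := Set.disjoint_sdiff_right
    rw [hsplit, measureReal_union (μ := μ) hdisj (hCm 0 _ hWm) (measure_ne_top _ _)
      (measure_ne_top _ _), setIntegral_union hdisj (hCm 0 _ hWm)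
      hf.integrableOn hf.integrableOn, mul_add]
    refine add_le_add (ih (fun k => C (k + 1)) (fun i j hij => hC (Nat.succ_le_succ hij))
      (fun k => hCm _) (fun k => U (k + 1)) (fun k => hU _) (fun k => hc _)) ?_
    rw [← setIntegral_condExp (hCm 0) hf hWm, mul_comm]
    calc μ.real (U 0 \ V) * c = ∫ x in U 0 \ V, c ∂μ := by simp
      _ ≤ _ := by
        refine setIntegral_mono_on_ae (integrable_const c).integrableOn
          integrable_condExp.integrableOn (hCm 0 _ hWm) ?_
        filter_upwards [hc 0] with x hx hxU using hx hxU.1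

theorem setIntegral_mul_condExp_eq [IsFiniteMeasure μ] {m : MeasurableSpace Ω} (hm : m ≤ m0)
    {f g : Ω → ℝ} (hf : Integrable f μ) (hg : StronglyMeasurable[m] g)
    (hgf : Integrable (fun x => g x * f x) μ) {s : Set Ω} (hs : MeasurableSet[m] s) :
    ∫ x in s, g x * (μ[f | m]) x ∂μ = ∫ x in s, g x * f x ∂μ := by
  rw [← setIntegral_condExp hm hgf hs]
  exact setIntegral_congr_ae (hm _ hs)
    ((condExp_mul_of_stronglyMeasurable_left hg hgf hf).symm.mono fun x hx _ => hx)

theorem ae_abs_condExp_le {m : MeasurableSpace Ω} {f : Ω → ℝ} {R : ℝ}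
    (hf : ∀ x, |f x| ≤ R) : ∀ᵐ x ∂μ, |(μ[f | m]) x| ≤ R := by
  have hfa : ∀ᵐ x ∂μ, |f x| ≤ R := ae_of_all _ hf
  exact ae_bdd_abs_condExp_of_ae_bdd_abs hfa

variable {C : ℕ → MeasurableSpace Ω} {f : Ω → ℝ} {R : ℝ}

/-- Second moment of the increments of a bounded reverse martingale. -/
theorem integral_sq_condExp_sub [IsFiniteMeasure μ] {m n : MeasurableSpace Ω} (hmn : n ≤ m)
    (hm : m ≤ m0) (hfR : ∀ x, |f x| ≤ R) :
    ∫ x, ((μ[f | m]) x - (μ[f | n]) x) ^ 2 ∂μ =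
      ∫ x, (μ[f | m]) x ^ 2 ∂μ - ∫ x, (μ[f | n]) x ^ 2 ∂μ := by
  have hM : Integrable (μ[f | m]) μ := integrable_condExp
  have hN : Integrable (μ[f | n]) μ := integrable_condExp
  have hMb := ae_abs_condExp_le (μ := μ) (m := m) hfR
  have hNb := ae_abs_condExp_le (μ := μ) (m := n) hfR
  have hMM : Integrable (fun x => (μ[f | m]) x * (μ[f | m]) x) μ :=
    hM.bdd_mul hM.aestronglyMeasurable hMb
  have hNM : Integrable (fun x => (μ[f | n]) x * (μ[f | m]) x) μ :=
    hM.bdd_mul hN.aestronglyMeasurable hNb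
  have hNN : Integrable (fun x => (μ[f | n]) x * (μ[f | n]) x) μ :=
    hN.bdd_mul hN.aestronglyMeasurable hNb
  have key : ∫ x, (μ[f | n]) x * (μ[f | m]) x ∂μ = ∫ x, (μ[f | n]) x * (μ[f | n]) x ∂μ := by
    rw [← setIntegral_univ, ← setIntegral_mul_condExp_eq (hmn.trans hm) hM
      stronglyMeasurable_condExp hNM MeasurableSet.univ, setIntegral_univ]
    refine integral_congr_ae ?_
    filter_upwards [condExp_condExp_of_le (μ := μ) (f := f) hmn hm] with x hx
    rw [hx]
  have h1 : ∀ x, ((μ[f | m]) x - (μ[f | n]) x) ^ 2 =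
      ((μ[f | m]) x * (μ[f | m]) x - 2 * ((μ[f | n]) x * (μ[f | m]) x)) +
        (μ[f | n]) x * (μ[f | n]) x := fun x => by ring
  have hA : Integrable (fun x => (μ[f | m]) x * (μ[f | m]) x -
      2 * ((μ[f | n]) x * (μ[f | m]) x)) μ := hMM.sub (hNM.const_mul 2)
  simp_rw [h1]
  rw [integral_add hA hNN, integral_sub hMM (hNM.const_mul 2), integral_const_mul, key]
  simp_rw [sq]
  ring

/-- The oscillation of a bounded reverse martingale after a large time is small with large
probability: by orthogonality of increments the second moments converge, and the maximal
inequality transfers this to the running oscillation. -/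
theorem exists_measure_oscillation_le [IsProbabilityMeasure μ] (hC : Antitone C)
    (hCm : ∀ k, C k ≤ m0) (hfR : ∀ x, |f x| ≤ R)
    {ε δ : ℝ} (hε : 0 < ε) (hδ : 0 < δ) :
    ∃ m, μ {x | ∃ n ≥ m, 2 * ε ≤ |(μ[f | C n]) x - (μ[f | C m]) x|} ≤ ENNReal.ofReal δ := by
  set M : ℕ → Ω → ℝ := fun n => μ[f | C n] with hM
  have hMi : ∀ n, Integrable (M n) μ := fun n => integrable_condExp
  have hMm : ∀ n, StronglyMeasurable[C n] (M n) := fun n => stronglyMeasurable_condExp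
  set a : ℕ → ℝ := fun n => ∫ x, M n x ^ 2 ∂μ with ha
  have hdiff : ∀ m n, m ≤ n → ∫ x, (M m x - M n x) ^ 2 ∂μ = a m - a n := fun m n hmn =>
    integral_sq_condExp_sub (hC hmn) (hCm m) hfR
  have hanti : Antitone a := fun m n hmn => by
    have h1 := hdiff m n hmn
    have h2 : 0 ≤ ∫ x, (M m x - M n x) ^ 2 ∂μ := integral_nonneg fun x => sq_nonneg _
    linarith
  have hbelow : BddBelow (Set.range a) :=
    ⟨0, by rintro _ ⟨n, rfl⟩; exact integral_nonneg fun x => sq_nonneg _⟩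
  have hcau := (tendsto_atTop_ciInf hanti hbelow).cauchySeq
  obtain ⟨m, hm⟩ := Metric.cauchySeq_iff'.1 hcau ((ε * δ) ^ 2) (by positivity)
  refine ⟨m, ?_⟩
  -- the first moment of an increment, by `2 |h| ≤ s + h² / s` with `s = ε δ`
  have hL1 : ∀ N ≥ m, ∫ x, |M m x - M N x| ∂μ ≤ ε * δ := by
    intro N hN
    have hs : 0 < ε * δ := by positivity
    have h1 : a m - a N ≤ (ε * δ) ^ 2 := by
      have := hm N hN
      rw [Real.dist_eq, abs_lt] at this
      linarith [this.1]
    have hi : Integrable (fun x => M m x - M N x) μ := (hMi m).sub (hMi N)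
    have hi2 : Integrable (fun x => (M m x - M N x) ^ 2) μ := by
      have : Integrable (fun x => (M m x - M N x) * (M m x - M N x)) μ := by
        refine hi.bdd_mul (c := R + R) hi.aestronglyMeasurable ?_
        filter_upwards [ae_abs_condExp_le (μ := μ) (m := C m) hfR,
          ae_abs_condExp_le (μ := μ) (m := C N) hfR] with x h1 h2
        exact (abs_sub _ _).trans (add_le_add h1 h2)
      simpa only [sq] using this
    calc ∫ x, |M m x - M N x| ∂μ
        ≤ ∫ x, (ε * δ / 2 + (2 * (ε * δ))⁻¹ * (M m x - M N x) ^ 2) ∂μ := by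
          refine integral_mono hi.abs ((integrable_const _).add (hi2.const_mul _)) fun x => ?_
          have h2 : 0 ≤ (2 * (ε * δ))⁻¹ * (|M m x - M N x| - ε * δ) ^ 2 := by positivity
          have h3 : (2 * (ε * δ))⁻¹ * (|M m x - M N x| - ε * δ) ^ 2 =
              (ε * δ / 2 + (2 * (ε * δ))⁻¹ * (M m x - M N x) ^ 2) - |M m x - M N x| := by
            rw [← sq_abs (M m x - M N x)]
            field_simp
            ring
          simp only
          linarith
      _ = ε * δ / 2 + (2 * (ε * δ))⁻¹ * (a m - a N) := by
          rw [integral_add (integrable_const _) (hi2.const_mul _), integral_const_mul,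
            hdiff m N hN]
          simp
      _ ≤ ε * δ / 2 + (2 * (ε * δ))⁻¹ * (ε * δ) ^ 2 := by gcongr
      _ = ε * δ := by field_simp; ring
  set V : ℕ → Set Ω := fun N => {x | ∃ n ≥ m, n < N ∧ 2 * ε ≤ |M n x - M m x|} with hV
  have hVU : {x | ∃ n ≥ m, 2 * ε ≤ |M n x - M m x|} = ⋃ N, V N := by
    ext x
    simp only [hV, Set.mem_ofPred_eq, Set.mem_iUnion]
    constructor
    · rintro ⟨n, h1, h2⟩
      exact ⟨n + 1, n, h1, n.lt_succ_self, h2⟩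
    · rintro ⟨N, n, h1, -, h2⟩
      exact ⟨n, h1, h2⟩
  have hVmono : Monotone V := fun i j hij x ⟨n, h1, h2, h3⟩ => ⟨n, h1, h2.trans_le hij, h3⟩
  change μ {x | ∃ n ≥ m, 2 * ε ≤ |M n x - M m x|} ≤ _
  rw [hVU, hVmono.measure_iUnion]
  refine iSup_le fun N => ?_
  rcases le_or_gt N m with hNm | hNm
  · have : V N = ∅ := by
      ext x
      simp only [hV, Set.mem_ofPred_eq, Set.mem_empty_iff_false, iff_false]
      rintro ⟨n, h1, h2, -⟩
      omega
    simp [this]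
  obtain ⟨p, rfl⟩ := Nat.exists_eq_add_of_lt hNm
  -- on the horizon `m ≤ n ≤ N`, `M n - M N` is the conditional expectation of `M m - M N`;
  -- truncating the index by `min k p` extends this finite family to a sequence
  set g : Ω → ℝ := fun x => |M m x - M (m + p + 1) x| with hg
  have hgi : Integrable g μ := ((hMi m).sub (hMi _)).abs
  set U : ℕ → Set Ω := fun k => {x | ε ≤ |M (m + min k p) x - M (m + p + 1) x|} with hU
  have hUm : ∀ k, MeasurableSet[C (m + min k p)] (U k) := by
    intro k
    have h1 : Measurable[C (m + min k p)] (M (m + min k p)) := (hMm _).measurable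
    have h2 : Measurable[C (m + min k p)] (M (m + p + 1)) :=
      (hMm _).measurable.mono (hC (by omega)) le_rfl
    exact measurableSet_le measurable_const
      (@Measurable.norm _ _ _ _ _ (C (m + min k p)) _ (h1.sub h2))
  have hVsub : V (m + p + 1) ⊆ ⋃ k < p + 1, U k := by
    rintro x ⟨n, h1, h2, h3⟩
    by_contra hx
    simp only [Set.mem_iUnion, not_exists, hU, Set.mem_ofPred_eq, not_le] at hx
    have h4 := hx (n - m) (by omega)
    have h5 := hx 0 (by omega)
    rw [show m + min (n - m) p = n by omega] at h4
    simp only [Nat.zero_min, add_zero] at h5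
    have := abs_sub_le (M n x) (M (m + p + 1) x) (M m x)
    rw [abs_sub_comm (M (m + p + 1) x)] at this
    linarith
  have hmax := mul_measureReal_iUnion_le_setIntegral hgi ε (p + 1)
    (fun k => C (m + min k p)) (fun i j hij => hC (by omega)) (fun k => hCm _) U hUm ?_
  · have h1 : ε * μ.real (⋃ k < p + 1, U k) ≤ ε * δ := by
      refine hmax.trans ((setIntegral_le_integral hgi (ae_of_all _ fun x => abs_nonneg _)).trans ?_)
      exact hL1 _ (by omega)
    have h2 := le_of_mul_le_mul_left h1 hε
    calc μ (V (m + p + 1)) ≤ μ (⋃ k < p + 1, U k) := measure_mono hVsub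
      _ = ENNReal.ofReal (μ.real (⋃ k < p + 1, U k)) := by simp
      _ ≤ ENNReal.ofReal δ := ENNReal.ofReal_le_ofReal h2
  · intro k
    have h1 : μ[M m - M (m + p + 1) | C (m + min k p)] =ᵐ[μ]
        M (m + min k p) - M (m + p + 1) := by
      refine (condExp_sub (hMi m) (hMi _) _).trans ?_
      refine EventuallyEq.sub (condExp_condExp_of_le (hC (by omega)) (hCm m)) ?_
      rw [condExp_of_stronglyMeasurable (hCm _) ((hMm _).mono (hC (by omega))) (hMi _)]
    filter_upwards [h1, abs_condExp_ae_le_condExp_abs (m := C (m + min k p)) (μ := μ)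
      (M m - M (m + p + 1))] with x h2 h3 hx
    simp only [Pi.abs_apply, h2] at h3
    exact (hx : ε ≤ _).trans h3

theorem ae_cauchySeq_condExp [IsProbabilityMeasure μ] (hC : Antitone C) (hCm : ∀ k, C k ≤ m0)
    (hfR : ∀ x, |f x| ≤ R) :
    ∀ᵐ x ∂μ, CauchySeq fun n => (μ[f | C n]) x := by
  have h1 : ∀ᵐ x ∂μ, ∀ j : ℕ, ∃ m, ∀ n ≥ m,
      |(μ[f | C n]) x - (μ[f | C m]) x| < 2 * (1 / ((j : ℝ) + 1)) := by
    refine ae_all_iff.2 fun j => ?_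
    rw [ae_iff]
    refine le_antisymm (ENNReal.le_of_forall_pos_le_add fun δ hδ _ => ?_) zero_le
    obtain ⟨m, hm⟩ := exists_measure_oscillation_le (μ := μ) hC hCm hfR
      (Nat.one_div_pos_of_nat (n := j)) (NNReal.coe_pos.2 hδ)
    rw [zero_add]
    refine (measure_mono fun x hx => ?_).trans (hm.trans (by simp))
    simp only [Set.mem_ofPred_eq, not_exists, not_forall, not_lt] at hx
    obtain ⟨n, h1, h2⟩ := hx m
    exact ⟨n, h1, h2⟩
  filter_upwards [h1] with x hx
  refine Metric.cauchySeq_iff'.2 fun ε hε => ?_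
  obtain ⟨j, hj⟩ := exists_nat_one_div_lt (half_pos hε)
  obtain ⟨m, hm⟩ := hx j
  exact ⟨m, fun n hn => (hm n hn).trans (by linarith)⟩

/-- **Reverse martingale convergence** for bounded functions. -/
theorem ae_tendsto_condExp_iInf [IsProbabilityMeasure μ] (hC : Antitone C) (hCm : ∀ k, C k ≤ m0)
    (hf : Integrable f μ) (hfR : ∀ x, |f x| ≤ R) :
    ∀ᵐ x ∂μ, Tendsto (fun n => (μ[f | C n]) x) atTop (𝓝 ((μ[f | ⨅ n, C n]) x)) := by
  -- the pointwise `limsup` does not see finitely many terms, hence is measurable for the infimum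
  set g : Ω → ℝ := fun x => limsup (fun n => (μ[f | C n]) x) atTop with hg
  have hgm : Measurable[⨅ n, C n] g := by
    intro s hs
    refine MeasurableSpace.measurableSet_iInf.2 fun k => ?_
    have h1 : g = fun x => limsup (fun n => (μ[f | C (n + k)]) x) atTop := by
      ext x
      exact (limsup_nat_add (fun n => (μ[f | C n]) x) k).symm
    rw [h1]
    exact Measurable.limsup (fun n =>
      stronglyMeasurable_condExp.measurable.mono (hC (Nat.le_add_left k n)) le_rfl) hs
  have hlim : ∀ᵐ x ∂μ, Tendsto (fun n => (μ[f | C n]) x) atTop (𝓝 (g x)) := by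
    filter_upwards [ae_cauchySeq_condExp (μ := μ) hC hCm hfR] with x hx
    obtain ⟨l, hl⟩ := cauchySeq_tendsto_of_complete hx
    have h1 : g x = l := hl.limsup_eq
    rwa [h1]
  have hle : ⨅ n, C n ≤ m0 := (iInf_le C 0).trans (hCm 0)
  have hbd : ∀ᵐ x ∂μ, ∀ n, |(μ[f | C n]) x| ≤ R :=
    ae_all_iff.2 fun n => ae_abs_condExp_le hfR
  have hgb : ∀ᵐ x ∂μ, ‖g x‖ ≤ R := by
    filter_upwards [hlim, hbd] with x h1 h2 using le_of_tendsto' h1.abs h2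
  have hgi : Integrable g μ := (integrable_const R).mono'
    (hgm.mono hle le_rfl).aestronglyMeasurable hgb
  have heq : g =ᵐ[μ] μ[f | ⨅ n, C n] := by
    refine ae_eq_condExp_of_forall_setIntegral_eq hle hf (fun _ _ _ => hgi.integrableOn) ?_
      hgm.stronglyMeasurable.aestronglyMeasurable
    intro s hs _
    have h1 : Tendsto (fun n => ∫ x in s, (μ[f | C n]) x ∂μ) atTop (𝓝 (∫ x in s, g x ∂μ)) := by
      refine tendsto_integral_of_dominated_convergence (fun _ => R)
        (fun n => integrable_condExp.aestronglyMeasurable.restrict)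
        (integrable_const R).integrableOn (fun n => ?_) (ae_restrict_of_ae hlim)
      filter_upwards [ae_restrict_of_ae hbd] with x hx using hx n
    refine tendsto_nhds_unique h1 (tendsto_const_nhds.congr fun n => ?_)
    exact (setIntegral_condExp (hCm n) hf (MeasurableSpace.measurableSet_iInf.1 hs n)).symm
  filter_upwards [hlim, heq] with x h1 h2
  rwa [← h2]

variable {A : Set Ω}

theorem ae_condExp_indicator_mem_Icc [IsFiniteMeasure μ] {m : MeasurableSpace Ω} (hm : m ≤ m0)
    (hA : MeasurableSet[m0] A) :
    ∀ᵐ x ∂μ, (μ[A.indicator (1 : Ω → ℝ) | m]) x ∈ Set.Icc (0 : ℝ) 1 := by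
  have hi : Integrable (A.indicator (1 : Ω → ℝ)) μ := (integrable_const (1 : ℝ)).indicator hA
  have h0 : 0 ≤ᵐ[μ] A.indicator (1 : Ω → ℝ) :=
    ae_of_all _ (Set.indicator_nonneg fun _ _ => zero_le_one)
  have h1 : A.indicator (1 : Ω → ℝ) ≤ᵐ[μ] fun _ => (1 : ℝ) :=
    ae_of_all _ fun x => Set.indicator_le_self' (fun _ _ => zero_le_one) x
  filter_upwards [condExp_nonneg (m := m) h0,
    condExp_mono (m := m) hi (integrable_const (1 : ℝ)) h1] with x h2 h3
  rw [condExp_const hm] at h3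
  exact ⟨h2, h3⟩

/-- The conditional probability of `A` is positive almost everywhere on `A`. -/
theorem ae_condExp_indicator_pos [IsFiniteMeasure μ] {m : MeasurableSpace Ω} (hm : m ≤ m0)
    (hA : MeasurableSet[m0] A) :
    ∀ᵐ x ∂μ, x ∈ A → 0 < (μ[A.indicator (1 : Ω → ℝ) | m]) x := by
  have hi : Integrable (A.indicator (1 : Ω → ℝ)) μ := (integrable_const (1 : ℝ)).indicator hA
  set Z : Set Ω := {x | (μ[A.indicator (1 : Ω → ℝ) | m]) x ≤ 0}
  have hZ : MeasurableSet[m] Z :=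
    measurableSet_le stronglyMeasurable_condExp.measurable measurable_const
  have h1 : ∫ x in Z, A.indicator (1 : Ω → ℝ) x ∂μ ≤ 0 := by
    rw [← setIntegral_condExp hm hi hZ]
    exact setIntegral_nonpos (hm _ hZ) fun x hx => hx
  have h3 := setIntegral_indicator (μ := μ) (s := Z) (f := (1 : Ω → ℝ)) hA
  rw [h3] at h1
  simp only [Pi.one_apply, setIntegral_const, smul_eq_mul, mul_one] at h1
  have h2 : μ (Z ∩ A) = 0 := by
    have := le_antisymm h1 measureReal_nonneg
    rwa [measureReal_eq_zero_iff] at this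
  filter_upwards [measure_eq_zero_iff_ae_notMem.1 h2] with x hx hxA
  by_contra hneg
  exact hx ⟨not_lt.1 hneg, hxA⟩

theorem measure_inter_exists_condExp_lt_le [IsProbabilityMeasure μ] (hC : Antitone C)
    (hCm : ∀ k, C k ≤ m0) (hA : MeasurableSet A) {l : ℝ} (hl : 0 ≤ l) :
    μ (A ∩ {x | ∃ k, (μ[A.indicator (1 : Ω → ℝ) | C k]) x < l}) ≤ ENNReal.ofReal l := by
  have hi : Integrable (A.indicator (1 : Ω → ℝ)) μ := (integrable_const (1 : ℝ)).indicator hA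
  set U : ℕ → Set Ω := fun k => {x | (μ[A.indicator (1 : Ω → ℝ) | C k]) x < l} with hU
  have hUm : ∀ k, MeasurableSet[C k] (U k) := fun k =>
    measurableSet_lt stronglyMeasurable_condExp.measurable measurable_const
  have hV : A ∩ {x | ∃ k, (μ[A.indicator (1 : Ω → ℝ) | C k]) x < l} =
      ⋃ N : ℕ, A ∩ ⋃ k < N, U k := by
    ext x
    simp only [hU, Set.mem_inter_iff, Set.mem_ofPred_eq, Set.mem_iUnion, exists_prop]
    constructor
    · rintro ⟨h1, k, h2⟩
      exact ⟨k + 1, h1, k, k.lt_succ_self, h2⟩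
    · rintro ⟨N, h1, k, -, h2⟩
      exact ⟨h1, k, h2⟩
  have hmono : Monotone fun N : ℕ => A ∩ ⋃ k < N, U k := fun i j hij =>
    Set.inter_subset_inter_right _ (Set.biUnion_mono (fun k (hk : k < i) => hk.trans_le hij)
      fun _ _ => subset_rfl)
  rw [hV, hmono.measure_iUnion]
  refine iSup_le fun N => ?_
  have hW : MeasurableSet (⋃ k < N, U k) :=
    MeasurableSet.iUnion fun k => MeasurableSet.iUnion fun _ => hCm k _ (hUm k)
  have h1 := mul_measureReal_iUnion_le_setIntegral (μ := μ) hi.neg (-l) N C hC hCm U hUm ?_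
  · simp only [Pi.neg_apply] at h1
    rw [integral_neg, setIntegral_indicator hA] at h1
    simp only [Pi.one_apply, setIntegral_const, smul_eq_mul, mul_one] at h1
    have h2 : μ.real (⋃ k < N, U k) ≤ 1 := measureReal_le_one
    have h3 : μ.real (A ∩ ⋃ k < N, U k) ≤ l := by
      rw [Set.inter_comm]
      nlinarith
    rw [← ofReal_measureReal]
    exact ENNReal.ofReal_le_ofReal h3
  · intro k
    filter_upwards [condExp_neg (μ := μ) (A.indicator (1 : Ω → ℝ)) (C k)] with x hx hxU
    rw [hx, Pi.neg_apply]
    exact neg_le_neg (le_of_lt hxU)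

/-- **Chung–Neveu lemma** for a decreasing sequence of `σ`-algebras: the supremum over `k` of the
information `-log μ(A | C k)` on `A` is dominated by an integrable function. -/
theorem exists_integrable_neg_log_condExp_le [IsProbabilityMeasure μ] (hC : Antitone C)
    (hCm : ∀ k, C k ≤ m0) (hA : MeasurableSet A) :
    ∃ G : Ω → ℝ, Integrable G μ ∧ (∀ x, 0 ≤ G x) ∧
      ∀ k, ∀ᵐ x ∂μ, x ∈ A → -Real.log ((μ[A.indicator (1 : Ω → ℝ) | C k]) x) ≤ G x := by
  set W : ℕ → Set Ω := fun j =>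
    A ∩ {x | ∃ k, (μ[A.indicator (1 : Ω → ℝ) | C k]) x < Real.exp (-j)} with hW
  have hWm : ∀ j, MeasurableSet (W j) := by
    intro j
    refine hA.inter ?_
    have : {x | ∃ k, (μ[A.indicator (1 : Ω → ℝ) | C k]) x < Real.exp (-j)} =
        ⋃ k, {x | (μ[A.indicator (1 : Ω → ℝ) | C k]) x < Real.exp (-j)} := by
      ext x
      simp
    rw [this]
    exact MeasurableSet.iUnion fun k => measurableSet_lt
      (stronglyMeasurable_condExp.measurable.mono (hCm k) le_rfl) measurable_const
  -- `F` counts the levels `exp (-j)` crossed by some conditional probability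
  set F : Ω → ENNReal := fun x => ∑' j, (W j).indicator 1 x with hF
  have hFm : Measurable F := Measurable.tsum fun j => measurable_one.indicator (hWm j)
  have hFfin : ∫⁻ x, F x ∂μ ≠ ⊤ := by
    have h1 : ∫⁻ x, F x ∂μ ≤ ∑' j : ℕ, ENNReal.ofReal (Real.exp (-j)) := by
      rw [hF, lintegral_tsum fun j => (measurable_one.indicator (hWm j)).aemeasurable]
      refine ENNReal.tsum_le_tsum fun j => ?_
      rw [lintegral_indicator_one (hWm j)]
      exact measure_inter_exists_condExp_lt_le hC hCm hA (Real.exp_pos _).le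
    refine ne_top_of_le_ne_top ?_ h1
    rw [← ENNReal.ofReal_tsum_of_nonneg (fun j => (Real.exp_pos _).le)
      Real.summable_exp_neg_nat]
    exact ENNReal.ofReal_ne_top
  refine ⟨fun x => (F x).toReal, integrable_toReal_of_lintegral_ne_top hFm.aemeasurable hFfin,
    fun x => ENNReal.toReal_nonneg, fun k => ?_⟩
  filter_upwards [ae_lt_top hFm hFfin, ae_condExp_indicator_pos (hCm k) hA] with x hx hpos hxA
  set t := -Real.log ((μ[A.indicator (1 : Ω → ℝ) | C k]) x) with ht
  have hmem : ∀ j ∈ Finset.range ⌈t⌉₊, (1 : ENNReal) ≤ (W j).indicator 1 x := by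
    intro j hj
    have hjt : (j : ℝ) < t := Nat.lt_ceil.1 (Finset.mem_range.1 hj)
    have : x ∈ W j := by
      refine ⟨hxA, k, ?_⟩
      rw [← Real.log_lt_iff_lt_exp (hpos hxA)]
      linarith
    simp [Set.indicator_of_mem this]
  have hcount : ((⌈t⌉₊ : ℕ) : ENNReal) ≤ F x := by
    calc ((⌈t⌉₊ : ℕ) : ENNReal) = ∑ j ∈ Finset.range ⌈t⌉₊, (1 : ENNReal) := by simp
      _ ≤ ∑ j ∈ Finset.range ⌈t⌉₊, (W j).indicator 1 x := Finset.sum_le_sum hmem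
      _ ≤ F x := ENNReal.sum_le_tsum _
  have := ENNReal.toReal_mono hx.ne hcount
  rw [ENNReal.toReal_natCast] at this
  exact (Nat.le_ceil t).trans this

end ReverseMartingale

/-! ### Conditional expectations and completion -/

section Completion

variable {X : Type*}

/-- Conditional expectations computed after an extension of the ambient `σ`-algebra: if every set
of `C` is almost everywhere equal to a set of `C' ≤ C`, the larger algebra may be replaced by
the smaller one. -/
theorem condExp_ae_eq_condExp_trim {m0 mc : MeasurableSpace X} {ν : @Measure X mc}
    [IsFiniteMeasure ν] (h0 : m0 ≤ mc) {C C' : MeasurableSpace X} (hC : C ≤ mc) (hC' : C' ≤ m0)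
    (hCC : C' ≤ C) (happ : ∀ s, MeasurableSet[C] s → ∃ t, MeasurableSet[C'] t ∧ s =ᵐ[ν] t)
    {f : X → ℝ} (hf : Integrable f (ν.trim h0)) :
    ν[f | C] =ᵐ[ν] (ν.trim h0)[f | C'] := by
  have hfin : IsFiniteMeasure (ν.trim h0) := isFiniteMeasure_trim h0
  set g := (ν.trim h0)[f | C'] with hg
  have hgm : StronglyMeasurable[C'] g := stronglyMeasurable_condExp
  have hgi : Integrable g (ν.trim h0) := integrable_condExp
  have hset : ∀ {h : X → ℝ}, Integrable h (ν.trim h0) → ∀ {t : Set X}, MeasurableSet[m0] t →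
      ∫ x in t, h x ∂ν = ∫ x in t, h x ∂(ν.trim h0) := by
    intro h hh t ht
    rw [restrict_trim h0 ν ht]
    refine integral_trim_ae h0 ?_
    rw [← restrict_trim h0 ν ht]
    exact hh.aestronglyMeasurable.restrict
  refine (ae_eq_condExp_of_forall_setIntegral_eq hC (integrable_of_integrable_trim h0 hf)
    (fun _ _ _ => (integrable_of_integrable_trim h0 hgi).integrableOn) ?_
    (hgm.mono hCC).aestronglyMeasurable).symm
  intro s hs _
  obtain ⟨t, ht, hst⟩ := happ s hs
  rw [setIntegral_congr_set hst, setIntegral_congr_set hst, hset hgi (hC' _ ht),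
    hset hf (hC' _ ht), setIntegral_condExp hC' hf ht]

variable {C C' m0 : MeasurableSpace X} {μ : Measure X}

theorem le_completeAlgebra : m0 ≤ completeAlgebra μ := le_eventuallyMeasurableSpace

theorem completed_trim : (completed μ).trim (le_completeAlgebra (μ := μ)) = μ := by
  refine @Measure.ext X m0 _ _ fun s hs => ?_
  rw [trim_measurableSet_eq _ hs, completed_apply]

theorem condE_ae_eq_of_le [IsFiniteMeasure μ]
    (hC : C ≤ completeAlgebra μ) (hC' : C' ≤ m0) (hCC : C' ≤ C)
    (happ : ∀ s, MeasurableSet[C] s → ∃ t, MeasurableSet[C'] t ∧ s =ᵐ[μ] t)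
    {f : X → ℝ} (hf : Integrable f μ) :
    condE μ C f =ᵐ[μ] μ[f | C'] := by
  have hfin : @IsFiniteMeasure X (completeAlgebra μ) (completed μ) :=
    @IsFiniteMeasure.mk X _ _ (by rw [completed_apply]; exact measure_lt_top μ _)
  have := condExp_ae_eq_condExp_trim (ν := completed μ) (le_completeAlgebra (μ := μ)) hC hC' hCC
    happ (f := f) (by rwa [completed_trim])
  rw [completed_trim] at this
  exact this

/-- A sub-`σ`-algebra of the completion that is closed under modification on null sets. -/
structure IsNullClosed {m0 : MeasurableSpace X} (μ : Measure X) (C : MeasurableSpace X) : Prop where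
  le : C ≤ @completeAlgebra X m0 μ
  congr : ∀ s t, MeasurableSet[C] s → t =ᵐ[μ] s → MeasurableSet[C] t

theorem condE_ae_eq_condExp_inf [IsFiniteMeasure μ]
    (hC : IsNullClosed μ C) {f : X → ℝ} (hf : Integrable f μ) :
    condE μ C f =ᵐ[μ] μ[f | C ⊓ m0] := by
  refine condE_ae_eq_of_le hC.le inf_le_right inf_le_left (fun s hs => ?_) hf
  obtain ⟨t, ht, hst⟩ := hC.le s hs
  exact ⟨t, MeasurableSpace.measurableSet_inf.2 ⟨hC.congr s t hs hst.symm, ht⟩, hst⟩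

theorem isNullClosed_hat (ξ : Setoid X) : IsNullClosed μ (hat μ ξ) where
  le := by
    rintro s ⟨t, ht, hst⟩
    obtain ⟨u, hu, htu⟩ := ht.1
    exact ⟨u, hu, hst.trans htu⟩
  congr := by
    rintro s t ⟨u, hu, hsu⟩ hts
    exact ⟨u, hu, hts.trans hsu⟩

theorem isNullClosed_iInf {C : ℕ → MeasurableSpace X} (hC : ∀ n, IsNullClosed μ (C n)) :
    IsNullClosed μ (⨅ n, C n) where
  le := (iInf_le C 0).trans (hC 0).le
  congr s t hs hts := MeasurableSpace.measurableSet_iInf.2 fun n =>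
    (hC n).congr s t (MeasurableSpace.measurableSet_iInf.1 hs n) hts

end Completion

/-! ### Conditional information of finite partitions -/

section ConditionalInformation

variable {X : Type*} {C m0 : MeasurableSpace X} {μ : Measure X} {α β : Setoid X}

theorem mem_atom_self (α : Setoid X) (x : X) : x ∈ atom α x := α.refl x

theorem mem_classes_iff_eq_atom {A : Set X} : A ∈ α.classes ↔ ∃ x, A = atom α x := Iff.rfl

theorem atom_eq_of_mem {x y : X} (h : y ∈ atom α x) : atom α y = atom α x := by
  ext z
  exact ⟨fun hz => α.trans hz h, fun hz => α.trans hz (α.symm h)⟩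

theorem eq_atom_of_mem_classes {A : Set X} {x : X} (hA : A ∈ α.classes) (hx : x ∈ A) :
    A = atom α x := by
  obtain ⟨y, rfl⟩ := mem_classes_iff_eq_atom.1 hA
  exact (atom_eq_of_mem hx).symm

theorem atom_comap (S : X → X) (α : Setoid X) (x : X) :
    atom (α.comap S) x = S ⁻¹' atom α (S x) := rfl

theorem IsFinitePartition.measurableSet_atom (hα : IsFinitePartition α) (x : X) :
    MeasurableSet (atom α x) := hα.2 _ (atom_mem_classes α x)

theorem IsFinitePartition.inf (hα : IsFinitePartition α) (hβ : IsFinitePartition β) :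
    IsFinitePartition (α ⊓ β) := by
  constructor
  · refine (hα.1.image2 (fun A B => A ∩ B) hβ.1).subset ?_
    intro A hA
    obtain ⟨x, rfl⟩ := mem_classes_iff_eq_atom.1 hA
    exact ⟨_, atom_mem_classes α x, _, atom_mem_classes β x, rfl⟩
  · intro A hA
    obtain ⟨x, rfl⟩ := mem_classes_iff_eq_atom.1 hA
    exact (hα.measurableSet_atom x).inter (hβ.measurableSet_atom x)

theorem IsFinitePartition.comap (hα : IsFinitePartition α) {S : X → X} (hS : Measurable S) :
    IsFinitePartition (α.comap S) := by
  constructor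
  · refine (hα.1.image (fun A => S ⁻¹' A)).subset ?_
    intro A hA
    obtain ⟨x, rfl⟩ := mem_classes_iff_eq_atom.1 hA
    exact ⟨_, atom_mem_classes α (S x), rfl⟩
  · intro A hA
    obtain ⟨x, rfl⟩ := mem_classes_iff_eq_atom.1 hA
    exact hS (hα.measurableSet_atom (S x))

theorem isFinitePartition_top : IsFinitePartition (⊤ : Setoid X) := by
  have h : ∀ A ∈ (⊤ : Setoid X).classes, A = Set.univ := by
    intro A hA
    obtain ⟨x, rfl⟩ := mem_classes_iff_eq_atom.1 hA
    exact Set.eq_univ_of_forall fun y => trivial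
  exact ⟨(Set.finite_singleton Set.univ).subset h, fun A hA => h A hA ▸ MeasurableSet.univ⟩

/-- A property of almost every point and its atom may be checked atom by atom. -/
theorem IsFinitePartition.ae_atom (hα : IsFinitePartition α) {p : Set X → X → Prop}
    (h : ∀ A ∈ α.classes, ∀ᵐ x ∂μ, x ∈ A → p A x) : ∀ᵐ x ∂μ, p (atom α x) x := by
  filter_upwards [(ae_ball_iff hα.1.countable).2 h] with x hx
  exact hx _ (atom_mem_classes α x) (mem_atom_self α x)

theorem info_eq_neg_log (α : Setoid X) (C : MeasurableSpace X) (x : X) :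
    info μ α C x = -Real.log (condE μ C ((atom α x).indicator 1) x) := by
  unfold info
  rw [finsum_eq_single _ (atom α x)]
  · rw [finsum_eq_single _ (atom_mem_classes α x) fun h hne => absurd rfl hne]
    simp [Set.indicator_of_mem (mem_atom_self α x)]
  · intro A hA
    by_cases h : A ∈ α.classes
    · have hx : x ∉ A := fun hx => hA (eq_atom_of_mem_classes h hx)
      simp [Set.indicator_of_notMem hx]
    · simp [h]

/-- The conditional information function computed with conditional probabilities relative to a
sub-`σ`-algebra of the given (not completed) `σ`-algebra. -/
noncomputable def condInfo (μ : Measure X) (α : Setoid X) (C : MeasurableSpace X) (x : X) : ℝ :=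
  -Real.log ((μ[(atom α x).indicator (1 : X → ℝ) | C]) x)

theorem integrable_indicator_one [IsFiniteMeasure μ] {A : Set X} (hA : MeasurableSet A) :
    Integrable (A.indicator (1 : X → ℝ)) μ := (integrable_const (1 : ℝ)).indicator hA

theorem condInfo_top [IsProbabilityMeasure μ] (hC : C ≤ m0) (x : X) :
    condInfo μ ⊤ C x = 0 := by
  have h1 : (atom (⊤ : Setoid X) x).indicator (1 : X → ℝ) = fun _ => 1 := by
    ext y
    exact Set.indicator_of_mem (s := atom (⊤ : Setoid X) x) trivial _
  rw [condInfo, h1, condExp_const hC, Real.log_one, neg_zero]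

theorem info_ae_eq_condInfo [IsFiniteMeasure μ] (hC : IsNullClosed μ C)
    (hα : IsFinitePartition α) : info μ α C =ᵐ[μ] condInfo μ α (C ⊓ m0) := by
  refine hα.ae_atom (μ := μ)
    (p := fun A x => info μ α C x = -Real.log ((μ[A.indicator (1 : X → ℝ) | C ⊓ m0]) x))
    fun A hA => ?_
  filter_upwards [condE_ae_eq_condExp_inf hC (integrable_indicator_one (hα.2 A hA))] with x hx hxA
  rw [info_eq_neg_log, ← eq_atom_of_mem_classes hA hxA, hx]

theorem condInfo_eq_sum (hα : IsFinitePartition α) (x : X) :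
    condInfo μ α C x = ∑ A ∈ hα.1.toFinset,
      A.indicator (fun y => -Real.log ((μ[A.indicator (1 : X → ℝ) | C]) y)) x := by
  rw [Finset.sum_eq_single (atom α x)]
  · rw [Set.indicator_of_mem (mem_atom_self α x)]
    rfl
  · intro A hA hne
    exact Set.indicator_of_notMem
      (fun hx => hne (eq_atom_of_mem_classes (hα.1.mem_toFinset.1 hA) hx)) _
  · intro h
    exact absurd (hα.1.mem_toFinset.2 (atom_mem_classes α x)) h

theorem measurable_condInfo (hC : C ≤ m0) (hα : IsFinitePartition α) :
    Measurable (condInfo μ α C) := by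
  have : condInfo μ α C = fun x => ∑ A ∈ hα.1.toFinset,
      A.indicator (fun y => -Real.log ((μ[A.indicator (1 : X → ℝ) | C]) y)) x :=
    funext (condInfo_eq_sum hα)
  rw [this]
  refine Finset.measurable_sum _ fun A hA => ?_
  exact (Real.measurable_log.comp
    (stronglyMeasurable_condExp.measurable.mono hC le_rfl)).neg.indicator
      (hα.2 A (hα.1.mem_toFinset.1 hA))

theorem ae_condInfo_nonneg [IsFiniteMeasure μ] (hC : C ≤ m0)
    (hα : IsFinitePartition α) : 0 ≤ᵐ[μ] condInfo μ α C := by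
  refine hα.ae_atom (μ := μ)
    (p := fun A x => (0 : ℝ) ≤ -Real.log ((μ[A.indicator (1 : X → ℝ) | C]) x)) fun A hA => ?_
  filter_upwards [ae_condExp_indicator_mem_Icc hC (hα.2 A hA)] with x hx _
  exact neg_nonneg.2 (Real.log_nonpos hx.1 hx.2)

theorem exists_integrable_condInfo_le [IsProbabilityMeasure μ] {C : ℕ → MeasurableSpace X}
    (hC : Antitone C) (hCm : ∀ k, C k ≤ m0) (hα : IsFinitePartition α) :
    ∃ G : X → ℝ, Integrable G μ ∧ ∀ k, ∀ᵐ x ∂μ, |condInfo μ α (C k) x| ≤ G x := by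
  choose! G hGi hG0 hG using fun A (hA : A ∈ α.classes) =>
    exists_integrable_neg_log_condExp_le (μ := μ) hC hCm (hα.2 A hA)
  refine ⟨fun x => ∑ A ∈ hα.1.toFinset, G A x,
    integrable_finsetSum _ fun A hA => hGi A (hα.1.mem_toFinset.1 hA), fun k => ?_⟩
  have h1 : ∀ᵐ x ∂μ, condInfo μ α (C k) x ≤ G (atom α x) x :=
    hα.ae_atom (p := fun A x => -Real.log ((μ[A.indicator (1 : X → ℝ) | C k]) x) ≤ G A x)
      fun A hA => hG A hA k
  filter_upwards [h1, ae_condInfo_nonneg (hCm k) hα] with x hx h0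
  rw [abs_of_nonneg h0]
  exact hx.trans (Finset.single_le_sum (f := fun A => G A x)
    (fun A hA => hG0 A (hα.1.mem_toFinset.1 hA) x)
    (hα.1.mem_toFinset.2 (atom_mem_classes α x)))

theorem integrable_condInfo [IsProbabilityMeasure μ] (hC : C ≤ m0)
    (hα : IsFinitePartition α) : Integrable (condInfo μ α C) μ := by
  obtain ⟨G, hGi, hG⟩ := exists_integrable_condInfo_le (μ := μ) (C := fun _ => C)
    antitone_const (fun _ => hC) hα
  exact hGi.mono' (measurable_condInfo hC hα).aestronglyMeasurable (hG 0)

theorem integrable_info [IsProbabilityMeasure μ] (hα : IsFinitePartition α)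
    (hC : IsNullClosed μ C) : Integrable (info μ α C) μ :=
  (integrable_condInfo inf_le_right hα).congr (info_ae_eq_condInfo hC hα).symm

theorem ae_tendsto_condInfo_iInf [IsProbabilityMeasure μ] {C : ℕ → MeasurableSpace X}
    (hC : Antitone C) (hCm : ∀ k, C k ≤ m0) (hα : IsFinitePartition α) :
    ∀ᵐ x ∂μ, Tendsto (fun k => condInfo μ α (C k) x) atTop (𝓝 (condInfo μ α (⨅ k, C k) x)) := by
  refine hα.ae_atom (p := fun A x => Tendsto
    (fun k => -Real.log ((μ[A.indicator (1 : X → ℝ) | C k]) x)) atTop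
    (𝓝 (-Real.log ((μ[A.indicator (1 : X → ℝ) | ⨅ k, C k]) x)))) fun A hA => ?_
  have hb : ∀ x, |A.indicator (1 : X → ℝ) x| ≤ 1 := fun x => by
    by_cases h : x ∈ A <;> simp [h]
  filter_upwards [ae_tendsto_condExp_iInf (μ := μ) hC hCm
    (integrable_indicator_one (hα.2 A hA)) hb, ae_condExp_indicator_pos
    ((iInf_le C 0).trans (hCm 0)) (hα.2 A hA)] with x h1 h2 hxA
  exact (h1.log (h2 hxA).ne').neg

end ConditionalInformation

/-! ### The chain rule -/

section ConditionalBayes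

variable {X : Type*} {C C' m0 : MeasurableSpace X} {μ : Measure X}

/-- The chain rule for conditional probabilities, `μ(B ∩ A | C) = μ(B | C) μ(A | C')` on `B`, valid
when `C'` contains `C` and `B`, and induces on `B` the same trace as `C`. -/
theorem ae_condExp_inter_eq_mul [IsFiniteMeasure μ] (hCC : C ≤ C') (hC' : C' ≤ m0) {A B : Set X}
    (hA : MeasurableSet[m0] A) (hB : MeasurableSet[C'] B)
    (htrace : ∀ s, MeasurableSet[C'] s →
      ∃ t, MeasurableSet[C] t ∧ (s ∩ B : Set X) =ᵐ[μ] (t ∩ B : Set X)) :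
    ∀ᵐ x ∂μ, x ∈ B → (μ[(B ∩ A).indicator (1 : X → ℝ) | C]) x =
      (μ[B.indicator (1 : X → ℝ) | C]) x * (μ[A.indicator (1 : X → ℝ) | C']) x := by
  have hC : C ≤ m0 := hCC.trans hC'
  have hB0 : MeasurableSet[m0] B := hC' _ hB
  set p := μ[B.indicator (1 : X → ℝ) | C] with hp
  set q := μ[(B ∩ A).indicator (1 : X → ℝ) | C] with hq
  have hpm : StronglyMeasurable[C] p := stronglyMeasurable_condExp
  have hqm : StronglyMeasurable[C] q := stronglyMeasurable_condExp
  have hpi : Integrable p μ := integrable_condExp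
  have hqi : Integrable q μ := integrable_condExp
  have hAi : Integrable (A.indicator (1 : X → ℝ)) μ := integrable_indicator_one hA
  have hBi : Integrable (B.indicator (1 : X → ℝ)) μ := integrable_indicator_one hB0
  have hBAi : Integrable ((B ∩ A).indicator (1 : X → ℝ)) μ :=
    integrable_indicator_one (hB0.inter hA)
  set F : X → ℝ := (B ∩ A).indicator p with hF
  have hFi : Integrable F μ := hpi.indicator (hB0.inter hA)
  -- replacing a test set `s` of `C'` by its trace partner `t` in `C`, both sides become `∫_t p q`
  have h1 : B.indicator q =ᵐ[μ] μ[F | C'] := by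
    refine ae_eq_condExp_of_forall_setIntegral_eq hC' hFi
      (fun _ _ _ => (hqi.indicator hB0).integrableOn) ?_
      ((hqm.mono hCC).indicator hB).aestronglyMeasurable
    intro s hs _
    obtain ⟨t, ht, hst⟩ := htrace s hs
    have ht0 : MeasurableSet[m0] t := hC _ ht
    have hqB : ∀ x, B.indicator q x = q x * B.indicator (1 : X → ℝ) x := fun x => by
      by_cases h : x ∈ B <;> simp [h]
    have hpBA : ∀ x, F x = p x * (B ∩ A).indicator (1 : X → ℝ) x := fun x => by
      by_cases h : x ∈ B ∩ A
      · simp only [hF, Set.indicator_of_mem h, Pi.one_apply, mul_one]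
      · simp only [hF, Set.indicator_of_notMem h, mul_zero]
    have hl : ∫ x in s, B.indicator q x ∂μ = ∫ x in t, B.indicator q x ∂μ := by
      rw [setIntegral_indicator hB0, setIntegral_indicator hB0, setIntegral_congr_set hst]
    have hFB : B.indicator F = F := by
      rw [hF, Set.indicator_indicator, ← Set.inter_assoc, Set.inter_self]
    have hr : ∫ x in s, F x ∂μ = ∫ x in t, F x ∂μ := by
      rw [← hFB, setIntegral_indicator hB0, setIntegral_indicator hB0, setIntegral_congr_set hst]
    rw [hl, hr]
    have hqi' : Integrable (fun x => q x * B.indicator (1 : X → ℝ) x) μ :=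
      (hqi.indicator hB0).congr (ae_of_all _ hqB)
    have hpi' : Integrable (fun x => p x * (B ∩ A).indicator (1 : X → ℝ) x) μ :=
      hFi.congr (ae_of_all _ hpBA)
    calc ∫ x in t, B.indicator q x ∂μ = ∫ x in t, q x * B.indicator (1 : X → ℝ) x ∂μ := by
          simp_rw [hqB]
      _ = ∫ x in t, q x * p x ∂μ := (setIntegral_mul_condExp_eq hC hBi hqm hqi' ht).symm
      _ = ∫ x in t, p x * q x ∂μ := by simp_rw [mul_comm]
      _ = ∫ x in t, p x * (B ∩ A).indicator (1 : X → ℝ) x ∂μ :=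
          setIntegral_mul_condExp_eq hC hBAi hpm hpi' ht
      _ = ∫ x in t, F x ∂μ := by simp_rw [hpBA]
  have h2 : F = B.indicator p * A.indicator (1 : X → ℝ) := by
    ext x
    by_cases hxB : x ∈ B <;> by_cases hxA : x ∈ A <;> simp [hF, hxB, hxA]
  have h3 : μ[F | C'] =ᵐ[μ] B.indicator p * μ[A.indicator (1 : X → ℝ) | C'] := by
    rw [h2]
    exact condExp_mul_of_stronglyMeasurable_left ((hpm.mono hCC).indicator hB) (h2 ▸ hFi) hAi
  filter_upwards [h1, h3] with x h4 h5 hxB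
  rw [← h4] at h5
  simpa [Set.indicator_of_mem hxB] using h5

/-- The chain rule for conditional information functions. -/
theorem condInfo_inf_ae_eq [IsFiniteMeasure μ] {α β : Setoid X} (hα : IsFinitePartition α)
    (hβ : IsFinitePartition β) (hCC : C ≤ C') (hC' : C' ≤ m0)
    (hβC : ∀ B ∈ β.classes, MeasurableSet[C'] B)
    (htrace : ∀ B ∈ β.classes, ∀ s, MeasurableSet[C'] s →
      ∃ t, MeasurableSet[C] t ∧ (s ∩ B : Set X) =ᵐ[μ] (t ∩ B : Set X)) :
    condInfo μ (β ⊓ α) C =ᵐ[μ] condInfo μ β C + condInfo μ α C' := by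
  have h : ∀ᵐ x ∂μ, ∀ B ∈ β.classes, ∀ A ∈ α.classes, x ∈ B → x ∈ A →
      -Real.log ((μ[(B ∩ A).indicator (1 : X → ℝ) | C]) x) =
        -Real.log ((μ[B.indicator (1 : X → ℝ) | C]) x) +
          -Real.log ((μ[A.indicator (1 : X → ℝ) | C']) x) := by
    refine (ae_ball_iff hβ.1.countable).2 fun B hB => (ae_ball_iff hα.1.countable).2 fun A hA => ?_
    filter_upwards [ae_condExp_inter_eq_mul hCC hC' (hα.2 A hA) (hβC B hB) (htrace B hB),
      ae_condExp_indicator_pos (hCC.trans hC') (hβ.2 B hB),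
      ae_condExp_indicator_pos hC' (hα.2 A hA)] with x h1 h2 h3 hxB hxA
    rw [h1 hxB, Real.log_mul (h2 hxB).ne' (h3 hxA).ne']
    ring
  filter_upwards [h] with x hx
  exact hx _ (atom_mem_classes β x) _ (atom_mem_classes α x) (mem_atom_self β x)
    (mem_atom_self α x)

end ConditionalBayes

/-! ### The `σ`-algebra of a measurable partition -/

section Saturation

variable {X : Type*} {m0 : MeasurableSpace X} {μ : Measure X} {ξ η β : Setoid X}

theorem eq_iUnion_atom_iff {A : Set X} :
    A = ⋃ x ∈ A, atom ξ x ↔ ∀ x ∈ A, ∀ y, ξ y x → y ∈ A := by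
  constructor
  · intro h x hx y hy
    rw [h]
    exact Set.mem_iUnion₂.2 ⟨x, hx, hy⟩
  · intro h
    refine Set.Subset.antisymm (fun x hx => Set.mem_iUnion₂.2 ⟨x, hx, ξ.refl x⟩) fun y hy => ?_
    obtain ⟨x, hx, hyx⟩ := Set.mem_iUnion₂.1 hy
    exact h x hx y hyx

theorem measurableSet_hat_iff {s : Set X} :
    MeasurableSet[hat μ ξ] s ↔
      ∃ t, (NullMeasurableSet t μ ∧ ∀ x ∈ t, ∀ y, ξ y x → y ∈ t) ∧ s =ᵐ[μ] t := by
  constructor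
  · rintro ⟨t, ht, hst⟩
    exact ⟨t, ⟨ht.1, eq_iUnion_atom_iff.1 ht.2⟩, hst⟩
  · rintro ⟨t, ht, hst⟩
    exact ⟨t, ⟨ht.1, eq_iUnion_atom_iff.2 ht.2⟩, hst⟩

theorem measurableSet_hat_inf_of_saturated {s : Set X} (hs : MeasurableSet s)
    (hsat : ∀ x ∈ s, ∀ y, ξ y x → y ∈ s) : MeasurableSet[hat μ ξ ⊓ m0] s :=
  MeasurableSpace.measurableSet_inf.2
    ⟨measurableSet_hat_iff.2 ⟨s, ⟨hs.nullMeasurableSet, hsat⟩, EventuallyEq.rfl⟩, hs⟩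

theorem hat_anti (h : ξ ≤ η) : hat μ η ≤ hat μ ξ := by
  intro s hs
  obtain ⟨t, ⟨ht, hsat⟩, hst⟩ := measurableSet_hat_iff.1 hs
  exact measurableSet_hat_iff.2 ⟨t, ⟨ht, fun x hx y hy => hsat x hx y (h hy)⟩, hst⟩

theorem iInf_rel_iff {ι : Sort*} (a : ι → Setoid X) (x y : X) :
    (⨅ i, a i) x y ↔ ∀ i, a i x y := Set.forall_mem_range

/-- A measurable partition is the fibre partition of a Borel map to the Baire space. -/
theorem IsMeasurablePartition.exists_code (hξ : IsMeasurablePartition ξ) :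
    ∃ π : X → ℕ → ℕ, Measurable π ∧ ∀ x y, π x = π y ↔ ξ x y := by
  obtain ⟨a, ha, rfl⟩ := hξ
  choose c hc using fun n => (Set.countable_iff_exists_injOn.1 (ha n).1.countable)
  have hcode : ∀ n x y, c n (atom (a n) x) = c n (atom (a n) y) ↔ a n x y := by
    intro n x y
    constructor
    · intro h
      have := hc n (atom_mem_classes (a n) x) (atom_mem_classes (a n) y) h
      have hx := mem_atom_self (a n) x
      rwa [this] at hx
    · intro h
      rw [atom_eq_of_mem (α := a n) (show x ∈ atom (a n) y from h)]
  refine ⟨fun x n => c n (atom (a n) x), measurable_pi_lambda _ fun n => ?_, fun x y => ?_⟩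
  · refine measurable_to_countable fun y => ?_
    have : (fun x => c n (atom (a n) x)) ⁻¹' {c n (atom (a n) y)} = atom (a n) y := by
      ext x
      exact hcode n x y
    rw [this]
    exact (ha n).measurableSet_atom y
  · rw [funext_iff]
    simp only [hcode, iInf_rel_iff]

theorem IsMeasurablePartition.measurableSet_atom (hξ : IsMeasurablePartition ξ) (x : X) :
    MeasurableSet (atom ξ x) := by
  obtain ⟨π, hπ, hπξ⟩ := hξ.exists_code
  have : atom ξ x = π ⁻¹' {π x} := by
    ext y
    exact (hπξ y x).symm
  rw [this]
  exact hπ (measurableSet_singleton _)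

/-- On an atom `B` of `β`, the partitions `ξ` and `ξ ∨ β` define the same sets up to null sets.
If `s` is a union of atoms of `ξ ∨ β`, then Borel sets that fill `s ∩ B` and `B \ s` up to null
sets have disjoint images under a Borel map coding `ξ`; these images are analytic, so by Lusin's
theorem a Borel set separates them, and its preimage is the required union of atoms of `ξ`. -/
theorem exists_measurableSet_hat_trace [StandardBorelSpace X] (hξ : IsMeasurablePartition ξ)
    {B : Set X} (hB : B ∈ β.classes) (hBm : MeasurableSet B) {s : Set X}
    (hs : MeasurableSet[hat μ (ξ ⊓ β)] s) :
    ∃ t, MeasurableSet[hat μ ξ ⊓ m0] t ∧ (s ∩ B : Set X) =ᵐ[μ] (t ∩ B : Set X) := by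
  obtain ⟨s', ⟨hs', hsat⟩, hss'⟩ := measurableSet_hat_iff.1 hs
  obtain ⟨π, hπ, hπξ⟩ := hξ.exists_code
  obtain ⟨K, hKs, hK, hKae⟩ :=
    (hs'.inter hBm.nullMeasurableSet).exists_measurable_subset_ae_eq
  obtain ⟨L, hLs, hL, hLae⟩ :=
    (hs'.compl.inter hBm.nullMeasurableSet).exists_measurable_subset_ae_eq
  have hdisj : Disjoint (π '' K) (π '' L) := by
    rw [Set.disjoint_left]
    rintro _ ⟨x, hx, rfl⟩ ⟨y, hy, hxy⟩
    have hβ : β y x := by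
      have h1 := eq_atom_of_mem_classes hB (hKs hx).2
      have h2 := (hLs hy).2
      rwa [h1] at h2
    exact (hLs hy).1 (hsat x (hKs hx).1 y ⟨(hπξ y x).1 hxy, hβ⟩)
  obtain ⟨D, hKD, hLD, hD⟩ :=
    (hK.analyticSet_image hπ).measurablySeparable (hL.analyticSet_image hπ) hdisj
  refine ⟨π ⁻¹' D, measurableSet_hat_inf_of_saturated (hπ hD) fun x hx y hy => ?_, ?_⟩
  · change π y ∈ D
    rw [(hπξ y x).2 hy]
    exact hx
  · have hK' : ∀ᵐ x ∂μ, x ∈ K ↔ x ∈ s' ∩ B := eventuallyEq_set.1 hKae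
    have hL' : ∀ᵐ x ∂μ, x ∈ L ↔ x ∈ s'ᶜ ∩ B := eventuallyEq_set.1 hLae
    have hs'' : ∀ᵐ x ∂μ, x ∈ s ↔ x ∈ s' := eventuallyEq_set.1 hss'
    refine eventuallyEq_set.2 ?_
    filter_upwards [hK', hL', hs''] with x h1 h2 h3
    simp only [Set.mem_inter_iff, Set.mem_preimage, and_congr_left_iff]
    intro hxB
    rw [h3]
    constructor
    · intro hx
      exact hKD ⟨x, h1.2 ⟨hx, hxB⟩, rfl⟩
    · intro hx
      by_contra hns
      exact Set.disjoint_left.1 hLD ⟨x, h2.2 ⟨hns, hxB⟩, rfl⟩ hx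

end Saturation

/-! ### Transport by a measure preserving map -/

section Transport

variable {X : Type*} {C m0 : MeasurableSpace X} {μ : Measure X}

theorem measurableSet_hat_inf_comap {S : X → X} (hS : MeasurePreserving S μ μ) {γ : Setoid X}
    {t : Set X} (ht : MeasurableSet[hat μ γ ⊓ m0] t) :
    MeasurableSet[hat μ (γ.comap S) ⊓ m0] (S ⁻¹' t) := by
  obtain ⟨h1, h2⟩ := MeasurableSpace.measurableSet_inf.1 ht
  obtain ⟨u, ⟨hu, hsat⟩, htu⟩ := measurableSet_hat_iff.1 h1
  refine MeasurableSpace.measurableSet_inf.2 ⟨measurableSet_hat_iff.2 ⟨S ⁻¹' u,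
    ⟨hu.preimage hS.quasiMeasurePreserving, fun x hx y hy => hsat (S x) hx (S y) hy⟩,
    hS.quasiMeasurePreserving.preimage_ae_eq htu⟩, hS.measurable h2⟩

theorem hat_comap_inf (S : X ≃ᵐ X) (hS : MeasurePreserving S μ μ) (γ : Setoid X) :
    hat μ (γ.comap S) ⊓ m0 = (hat μ γ ⊓ m0).comap S := by
  apply le_antisymm
  · intro s hs
    refine ⟨S.symm ⁻¹' s, ?_, ?_⟩
    · have := measurableSet_hat_inf_comap (hS.symm S) hs
      have hγ : (γ.comap S).comap S.symm = γ := by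
        ext x y
        simp [Setoid.comap_rel]
      rwa [hγ] at this
    · ext x
      simp
  · rintro _ ⟨t, ht, rfl⟩
    exact measurableSet_hat_inf_comap hS ht

theorem condExp_comp_ae_eq [IsFiniteMeasure μ] (hC : C ≤ m0) (S : X ≃ᵐ X)
    (hS : MeasurePreserving S μ μ) {f : X → ℝ} (hf : Integrable f μ) :
    μ[f ∘ S | C.comap S] =ᵐ[μ] μ[f | C] ∘ S := by
  have hle : C.comap S ≤ m0 := (MeasurableSpace.comap_mono hC).trans S.measurable.comap_le
  refine (ae_eq_condExp_of_forall_setIntegral_eq hle (hS.integrable_comp_of_integrable hf)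
    (fun _ _ _ => (hS.integrable_comp_of_integrable integrable_condExp).integrableOn) ?_
    ?_).symm
  · rintro _ ⟨t, ht, rfl⟩ _
    have h1 := hS.setIntegral_preimage_emb S.measurableEmbedding (μ[f | C]) t
    have h2 := hS.setIntegral_preimage_emb S.measurableEmbedding f t
    simp only [Function.comp_apply]
    rw [h1, h2, setIntegral_condExp hC hf ht]
  · exact (stronglyMeasurable_condExp.comp_measurable
      (comap_measurable _)).aestronglyMeasurable

theorem condInfo_comap_ae_eq [IsFiniteMeasure μ] (hC : C ≤ m0) (S : X ≃ᵐ X)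
    (hS : MeasurePreserving S μ μ) {α : Setoid X} (hα : IsFinitePartition α) :
    condInfo μ (α.comap S) (C.comap S) =ᵐ[μ] condInfo μ α C ∘ S := by
  have h : ∀ᵐ x ∂μ, ∀ A ∈ α.classes, (μ[(S ⁻¹' A).indicator (1 : X → ℝ) | C.comap S]) x =
      (μ[A.indicator (1 : X → ℝ) | C]) (S x) :=
    (ae_ball_iff hα.1.countable).2 fun A hA =>
      condExp_comp_ae_eq hC S hS (integrable_indicator_one (hα.2 A hA))
  filter_upwards [h] with x hx
  simp only [condInfo, Function.comp_apply, atom_comap, hx _ (atom_mem_classes α (S x))]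

end Transport

/-! ### Windows and the partitions `γ_n` -/

section Windows

variable {X : Type*} [TopologicalSpace X] (T : X ≃ₜ X) (α ξ : Setoid X)

theorem homeomorph_zpow_natCast_apply (n : ℕ) (x : X) : (T ^ (n : ℤ) : X ≃ₜ X) x = T^[n] x := by
  rw [zpow_natCast]
  induction n generalizing x with
  | zero => rfl
  | succ n ih =>
    rw [pow_succ, Function.iterate_succ_apply, ← ih]
    rfl

theorem window_rel_iff (N : ℕ) (x y : X) :
    window T α 0 ((N : ℤ) - 1) x y ↔ ∀ k < N, α (T^[k] x) (T^[k] y) := by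
  refine (iInf_rel_iff _ x y).trans ((forall_congr' fun k => iInf_rel_iff _ x y).trans ?_)
  constructor
  · intro h k hk
    have : α ((T ^ (- -(k : ℤ)) : X ≃ₜ X) x) ((T ^ (- -(k : ℤ)) : X ≃ₜ X) y) :=
      h k ⟨by omega, by omega⟩
    rwa [neg_neg, homeomorph_zpow_natCast_apply, homeomorph_zpow_natCast_apply] at this
  · rintro h k ⟨h0, hk⟩
    lift k to ℕ using h0
    change α ((T ^ (- -(k : ℤ)) : X ≃ₜ X) x) ((T ^ (- -(k : ℤ)) : X ≃ₜ X) y)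
    rw [neg_neg, homeomorph_zpow_natCast_apply, homeomorph_zpow_natCast_apply]
    exact h k (by omega)

theorem past_rel_iff (x y : X) :
    past T α x y ↔ ∀ k : ℤ, 1 ≤ k → α ((T ^ (-k) : X ≃ₜ X) x) ((T ^ (-k) : X ≃ₜ X) y) :=
  (iInf_rel_iff _ x y).trans (forall_congr' fun _ => iInf_rel_iff _ x y)

theorem window_zero : window T α 0 (((0 : ℕ) : ℤ) - 1) = ⊤ := by
  ext x y
  rw [window_rel_iff]
  exact ⟨fun _ => trivial, fun _ k hk => absurd hk k.not_lt_zero⟩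

theorem window_succ (N : ℕ) : window T α 0 (((N + 1 : ℕ) : ℤ) - 1) =
    window T α 0 ((N : ℤ) - 1) ⊓ α.comap (T^[N]) := by
  ext x y
  have hinf : (window T α 0 ((N : ℤ) - 1) ⊓ α.comap (T^[N])) x y ↔
      window T α 0 ((N : ℤ) - 1) x y ∧ α (T^[N] x) (T^[N] y) := Iff.rfl
  rw [hinf]
  simp only [Nat.lt_succ_iff_lt_or_eq, window_rel_iff]
  constructor
  · intro h
    exact ⟨fun k hk => h k (Or.inl hk), h N (Or.inr rfl)⟩
  · rintro ⟨h1, h2⟩ k (hk | rfl)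
    · exact h1 k hk
    · exact h2

theorem isFinitePartition_window [MeasurableSpace X] [BorelSpace X] {α : Setoid X}
    (hα : IsFinitePartition α) (N : ℕ) : IsFinitePartition (window T α 0 ((N : ℤ) - 1)) := by
  induction N with
  | zero =>
    rw [window_zero]
    exact isFinitePartition_top
  | succ N ih =>
    rw [window_succ]
    exact ih.inf (hα.comap (T.continuous.iterate N).measurable)

variable {T α ξ}

/-- Since `α⁻ ≺ ξ`, one has `ξ ∨ α_0^{N-1} = T^{-N} γ_N`. -/
theorem inf_window_eq_comap_gammaPart (h : ξ ≤ past T α) (N : ℕ) :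
    ξ ⊓ window T α 0 ((N : ℤ) - 1) = (gammaPart T α ξ N).comap (T^[N]) := by
  have hshift : ∀ (k : ℤ) (x : X),
      (T ^ (-k) : X ≃ₜ X) (T^[N] x) = (T ^ ((N : ℤ) - k) : X ≃ₜ X) x := by
    intro k x
    rw [← homeomorph_zpow_natCast_apply, ← Homeomorph.mul_apply, ← zpow_add,
      neg_add_eq_sub]
  ext x y
  have hξ : translate T N ξ (T^[N] x) (T^[N] y) ↔ ξ x y := by
    rw [translate, Setoid.comap_rel, hshift, hshift, sub_self, zpow_zero]
    exact Iff.rfl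
  have hl : (ξ ⊓ window T α 0 ((N : ℤ) - 1)) x y ↔
      ξ x y ∧ window T α 0 ((N : ℤ) - 1) x y := Iff.rfl
  have hr : (gammaPart T α ξ N).comap (T^[N]) x y ↔
      past T α (T^[N] x) (T^[N] y) ∧ translate T N ξ (T^[N] x) (T^[N] y) := Iff.rfl
  rw [hl, hr, hξ, window_rel_iff, past_rel_iff, and_comm]
  refine and_congr_left fun hxy => ?_
  simp only [hshift]
  constructor
  · intro hw k hk
    rcases lt_or_ge (N : ℤ) k with hkN | hkN
    · have := (past_rel_iff T α x y).1 (h hxy) (k - N) (by omega)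
      rwa [neg_sub] at this
    · obtain ⟨j, hj⟩ := Int.eq_ofNat_of_zero_le (sub_nonneg.2 hkN)
      rw [hj, homeomorph_zpow_natCast_apply, homeomorph_zpow_natCast_apply]
      exact hw j (by omega)
  · intro hp k hk
    have := hp ((N : ℤ) - k) (by omega)
    rwa [sub_sub_cancel, homeomorph_zpow_natCast_apply, homeomorph_zpow_natCast_apply] at this

theorem monotone_gammaPart (h : ξ ≤ translate T 1 ξ) : Monotone (gammaPart T α ξ) := by
  refine monotone_nat_of_le_succ fun n => inf_le_inf le_rfl ?_
  intro x y hxy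
  have h1 : ξ ((T ^ (-1 : ℤ) : X ≃ₜ X) ((T ^ (-(n : ℤ)) : X ≃ₜ X) x))
      ((T ^ (-1 : ℤ) : X ≃ₜ X) ((T ^ (-(n : ℤ)) : X ≃ₜ X) y)) := h hxy
  change ξ ((T ^ (-((n + 1 : ℕ) : ℤ)) : X ≃ₜ X) x) ((T ^ (-((n + 1 : ℕ) : ℤ)) : X ≃ₜ X) y)
  rwa [← Homeomorph.mul_apply, ← Homeomorph.mul_apply, ← zpow_add,
    show (-1 + -(n : ℤ)) = -((n + 1 : ℕ) : ℤ) by push_cast; ring] at h1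

end Windows

/-! ### The relative Shannon–McMillan–Breiman theorem -/

section Cocycle

variable {X : Type*} [TopologicalSpace X] [m0 : MeasurableSpace X] {T : X ≃ₜ X}
  {μ : Measure X} {α ξ : Setoid X}

/-- The `σ`-algebras of Borel sets in `γ̂_k` decrease to the Borel part of the tail algebra. -/
theorem iInf_hat_gammaPart_inf : ⨅ k, (hat μ (gammaPart T α ξ k) ⊓ m0) =
    tailAlgebra μ T α ξ ⊓ m0 := iInf_inf.symm

theorem antitone_hat_gammaPart_inf (h : ξ ≤ translate T 1 ξ) :
    Antitone fun k => hat μ (gammaPart T α ξ k) ⊓ m0 := fun _ _ hij =>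
  inf_le_inf_right _ (hat_anti (monotone_gammaPart h hij))

theorem isNullClosed_tailAlgebra : IsNullClosed μ (tailAlgebra μ T α ξ) :=
  isNullClosed_iInf fun _ => isNullClosed_hat _

theorem condE_invariants_ae_eq [IsFiniteMeasure μ] {f : X → ℝ} (hf : Integrable f μ) :
    condE μ (MeasurableSpace.invariants T) f =ᵐ[μ] μ[f | MeasurableSpace.invariants T] :=
  condE_ae_eq_of_le ((MeasurableSpace.invariants_le T).trans le_completeAlgebra)
    (MeasurableSpace.invariants_le T) le_rfl (fun s hs => ⟨s, hs, EventuallyEq.rfl⟩) hf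

theorem condE_invariants_info_ae_eq [IsProbabilityMeasure μ] (hα : IsFinitePartition α) :
    condE μ (MeasurableSpace.invariants T) (info μ α (tailAlgebra μ T α ξ)) =ᵐ[μ]
      μ[condInfo μ α (tailAlgebra μ T α ξ ⊓ m0) | MeasurableSpace.invariants T] := by
  have h := info_ae_eq_condInfo (μ := μ) (isNullClosed_tailAlgebra (T := T) (α := α) (ξ := ξ)) hα
  exact (condE_invariants_ae_eq ((integrable_condInfo inf_le_right hα).congr h.symm)).trans
    (condExp_congr_ae h)

theorem condE_invariants_info_ae_eq_condEntropy [IsProbabilityMeasure μ] (hT : Ergodic T μ)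
    (hα : IsFinitePartition α) :
    ∀ᵐ x ∂μ, condE μ (MeasurableSpace.invariants T) (info μ α (tailAlgebra μ T α ξ)) x =
      condEntropy μ α (tailAlgebra μ T α ξ) := by
  set g' : X → ℝ := condInfo μ α (tailAlgebra μ T α ξ ⊓ m0) with hg'
  have hm := MeasurableSpace.invariants_le T
  obtain ⟨c, hc⟩ := hT.toPreErgodic.ae_eq_const_of_ae_eq_comp
    (stronglyMeasurable_condExp.measurable.mono hm le_rfl) (condExp_invariants_comp (μ := μ) g')
  have hent : condEntropy μ α (tailAlgebra μ T α ξ) = c := by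
    have h1 : condEntropy μ α (tailAlgebra μ T α ξ) = ∫ x, g' x ∂μ :=
      integral_congr_ae (info_ae_eq_condInfo isNullClosed_tailAlgebra hα)
    rw [h1, ← integral_condExp hm, integral_congr_ae hc]
    simp
  filter_upwards [condE_invariants_info_ae_eq (T := T) (ξ := ξ) hα, hc] with x h1 h2
  rw [h1, h2, hent, Function.const_apply]

variable [BorelSpace X]

/-- The information of `α_0^{N-1}` given `ξ` is the non-stationary Birkhoff sum
`∑_{k < N} I(α | γ_k) ∘ T^k`. -/
theorem condInfo_window_ae_eq_sum [StandardBorelSpace X] [IsProbabilityMeasure μ]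
    (hT : MeasurePreserving T μ μ) (hξ : IsMeasurablePartition ξ) (hα : IsFinitePartition α)
    (hαξ : ξ ≤ past T α) (N : ℕ) :
    condInfo μ (window T α 0 ((N : ℤ) - 1)) (hat μ ξ ⊓ m0) =ᵐ[μ] fun x =>
      ∑ k ∈ Finset.range N, condInfo μ α (hat μ (gammaPart T α ξ k) ⊓ m0) (T^[k] x) := by
  induction N with
  | zero =>
    rw [window_zero]
    exact ae_of_all _ fun x => by rw [condInfo_top inf_le_right]; simp
  | succ N ih =>
    set S : X ≃ᵐ X := (T ^ (N : ℤ) : X ≃ₜ X).toMeasurableEquiv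
    have hSN : ⇑S = T^[N] := funext fun x => homeomorph_zpow_natCast_apply T N x
    have hS : MeasurePreserving S μ μ := hSN ▸ hT.iterate N
    have hβ := isFinitePartition_window T hα N
    have hC' : hat μ (ξ ⊓ window T α 0 ((N : ℤ) - 1)) ⊓ m0 =
        (hat μ (gammaPart T α ξ N) ⊓ m0).comap S := by
      rw [inf_window_eq_comap_gammaPart hαξ, ← hSN, hat_comap_inf S hS]
    have hchain := condInfo_inf_ae_eq (μ := μ) (C := hat μ ξ ⊓ m0)
      (C' := hat μ (ξ ⊓ window T α 0 ((N : ℤ) - 1)) ⊓ m0)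
      (hα.comap S.measurable) hβ (inf_le_inf_right _ (hat_anti inf_le_left)) inf_le_right
      (fun B hB => measurableSet_hat_inf_of_saturated (hβ.2 B hB) fun x hx y hy => by
        rw [eq_atom_of_mem_classes hB hx]
        exact hy.2)
      (fun B hB s hs => exists_measurableSet_hat_trace hξ hB (hβ.2 B hB)
        (MeasurableSpace.measurableSet_inf.1 hs).1)
    rw [hC'] at hchain
    have htrans := condInfo_comap_ae_eq (μ := μ) (C := hat μ (gammaPart T α ξ N) ⊓ m0)
      inf_le_right S hS hα
    rw [window_succ, ← hSN]
    filter_upwards [ih, hchain, htrans] with x h1 h2 h3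
    rw [h2, Pi.add_apply, h1, h3, Finset.sum_range_succ, Function.comp_apply, hSN]

theorem ae_forall_info_window_eq_sum [StandardBorelSpace X] [IsProbabilityMeasure μ]
    (hT : MeasurePreserving T μ μ) (hξ : IsMeasurablePartition ξ) (hα : IsFinitePartition α)
    (hαξ : ξ ≤ past T α) :
    ∀ᵐ x ∂μ, ∀ N : ℕ, info μ (window T α 0 ((N : ℤ) - 1)) (hat μ ξ) x =
      ∑ k ∈ Finset.range N, condInfo μ α (hat μ (gammaPart T α ξ k) ⊓ m0) (T^[k] x) :=
  ae_all_iff.2 fun N =>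
    (info_ae_eq_condInfo (isNullClosed_hat ξ) (isFinitePartition_window T hα N)).trans
      (condInfo_window_ae_eq_sum hT hξ hα hαξ N)

/-- The relative Shannon–McMillan–Breiman theorem, almost everywhere convergence. -/
theorem ae_tendsto_info_window [StandardBorelSpace X] [IsProbabilityMeasure μ]
    (hT : MeasurePreserving T μ μ) (hξ : IsMeasurablePartition ξ) (hTξ : ξ ≤ translate T 1 ξ)
    (hα : IsFinitePartition α) (hαξ : ξ ≤ past T α) :
    ∀ᵐ x ∂μ, Tendsto
      (fun N : ℕ => (1 / (N : ℝ)) * info μ (window T α 0 ((N : ℤ) - 1)) (hat μ ξ) x) atTop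
      (𝓝 (condE μ (MeasurableSpace.invariants T) (info μ α (tailAlgebra μ T α ξ)) x)) := by
  have hanti := antitone_hat_gammaPart_inf (μ := μ) (α := α) hTξ
  have hle : ∀ k, hat μ (gammaPart T α ξ k) ⊓ m0 ≤ m0 := fun _ => inf_le_right
  obtain ⟨G, hGi, hG⟩ := exists_integrable_condInfo_le (μ := μ) hanti hle hα
  have hlim := ae_tendsto_condInfo_iInf (μ := μ) hanti hle hα
  rw [iInf_hat_gammaPart_inf] at hlim
  filter_upwards [ae_forall_info_window_eq_sum hT hξ hα hαξ, condE_invariants_info_ae_eq hα,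
    ae_tendsto_average_comp_iterate hT
      (fun k => (measurable_condInfo (hle k) hα).aestronglyMeasurable) hGi hG hlim] with x h1 h2 h3
  rw [h2]
  simp only [h1]
  exact h3

/-- The relative Shannon–McMillan–Breiman theorem, convergence in `L¹`. -/
theorem tendsto_eLpNorm_info_window [StandardBorelSpace X] [IsProbabilityMeasure μ]
    (hT : MeasurePreserving T μ μ) (hξ : IsMeasurablePartition ξ) (hTξ : ξ ≤ translate T 1 ξ)
    (hα : IsFinitePartition α) (hαξ : ξ ≤ past T α) :
    Tendsto
      (fun N : ℕ => eLpNorm (fun x => (1 / (N : ℝ)) *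
          info μ (window T α 0 ((N : ℤ) - 1)) (hat μ ξ) x -
          condE μ (MeasurableSpace.invariants T) (info μ α (tailAlgebra μ T α ξ)) x) 1 μ)
      atTop (𝓝 0) := by
  have hanti := antitone_hat_gammaPart_inf (μ := μ) (α := α) hTξ
  have hle : ∀ k, hat μ (gammaPart T α ξ k) ⊓ m0 ≤ m0 := fun _ => inf_le_right
  set g : ℕ → X → ℝ := fun k => condInfo μ α (hat μ (gammaPart T α ξ k) ⊓ m0) with hg
  set g' : X → ℝ := condInfo μ α (tailAlgebra μ T α ξ ⊓ m0) with hg'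
  have hgi : ∀ k, Integrable (g k) μ := fun k => integrable_condInfo (hle k) hα
  have hgTi : ∀ k, Integrable (fun x => g k (T^[k] x)) μ := fun k =>
    (hT.iterate k).integrable_comp_of_integrable (hgi k)
  have hsum := ae_forall_info_window_eq_sum (μ := μ) hT hξ hα hαξ
  have hinfo : ∀ N : ℕ, info μ (window T α 0 ((N : ℤ) - 1)) (hat μ ξ) =ᵐ[μ] fun x =>
      ∑ k ∈ Finset.range N, g k (T^[k] x) := fun N => hsum.mono fun x hx => hx N
  have hinfoi : ∀ N : ℕ, Integrable (info μ (window T α 0 ((N : ℤ) - 1)) (hat μ ξ)) μ :=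
    fun N => (integrable_finsetSum _ fun k _ => hgTi k).congr (hinfo N).symm
  have hE := condE_invariants_info_ae_eq (μ := μ) (T := T) (ξ := ξ) hα
  refine tendsto_eLpNorm_one_of_nonneg (fun N => (hinfoi N).const_mul _)
    (integrable_condExp.congr hE.symm) (fun N => ?_)
    (ae_tendsto_info_window hT hξ hTξ hα hαξ) ?_
  · filter_upwards [info_ae_eq_condInfo (isNullClosed_hat ξ) (isFinitePartition_window T hα N),
      ae_condInfo_nonneg (C := hat μ ξ ⊓ m0) inf_le_right
        (isFinitePartition_window T hα N)] with x h1 h2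
    rw [h1]
    exact mul_nonneg (by positivity) h2
  · have hmean : Tendsto (fun k => ∫ x, g k x ∂μ) atTop (𝓝 (∫ x, g' x ∂μ)) := by
      obtain ⟨G, hGi, hG⟩ := exists_integrable_condInfo_le (μ := μ) hanti hle hα
      have hlim := ae_tendsto_condInfo_iInf (μ := μ) hanti hle hα
      rw [iInf_hat_gammaPart_inf] at hlim
      exact tendsto_integral_of_dominated_convergence G
        (fun k => (hgi k).aestronglyMeasurable) hGi hG hlim
    rw [integral_congr_ae hE, integral_condExp (MeasurableSpace.invariants_le T)]
    refine hmean.cesaro.congr fun N => ?_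
    rw [integral_const_mul, integral_congr_ae (hinfo N), integral_finsetSum _ fun k _ => hgTi k,
      one_div]
    congr 1
    refine Finset.sum_congr rfl fun k _ => ?_
    conv_lhs => rw [← (hT.iterate k).map_eq]
    exact integral_map (hT.iterate k).measurable.aemeasurable
      (by rw [(hT.iterate k).map_eq]; exact (hgi k).aestronglyMeasurable)

end Cocycle

/-! ### Disintegrations -/

section Disintegration

variable {X : Type*} {m0 : MeasurableSpace X} {μ : Measure X} {ξ : Setoid X} {X' : Set X}
  {κ : X → Measure X}

theorem IsDisintegration.ae_condE_indicator (h : IsDisintegration μ ξ X' κ) [IsFiniteMeasure μ]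
    {A : Set X} (hA : MeasurableSet A) :
    ∀ᵐ x ∂μ, condE μ (hat μ ξ) (A.indicator 1) x = (κ x).real A := by
  filter_upwards [h.condE_eq _ (measurable_one.indicator hA) (integrable_indicator_one hA)]
    with x hx
  rw [hx, integral_indicator_one hA]

theorem IsDisintegration.ae_apply_eq_one (h : IsDisintegration μ ξ X' κ) [IsProbabilityMeasure μ]
    {A : Set X} (hA : MeasurableSet A) (hAμ : A ∈ ae μ) : ∀ᵐ x ∂μ, κ x A = 1 := by
  have h1 : A.indicator (1 : X → ℝ) =ᵐ[μ] fun _ => (1 : ℝ) := by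
    filter_upwards [hAμ] with x hx
    simp [hx]
  have h2 : μ[A.indicator (1 : X → ℝ) | hat μ ξ ⊓ m0] =ᵐ[μ] fun _ => (1 : ℝ) := by
    refine (condExp_congr_ae h1).trans ?_
    rw [condExp_const inf_le_right]
  filter_upwards [h.ae_condE_indicator hA,
    condE_ae_eq_condExp_inf (isNullClosed_hat ξ) (integrable_indicator_one hA), h2] with x h3 h4 h5
  rw [h3, h5] at h4
  exact (ENNReal.toReal_eq_one_iff _).1 h4

/-- Every almost sure property holds on a Borel set of full measure that has full conditional
measure in each atom that it meets. The set is the intersection of Borel sets of full measure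
chosen successively so that `κ x` gives full mass to each one for every `x` in the next: passing to
Borel subsets is needed because `x ↦ κ x A` is only almost everywhere equal to a Borel function. -/
theorem IsDisintegration.exists_measurableSet_full (h : IsDisintegration μ ξ X' κ)
    [IsProbabilityMeasure μ] (hξ : IsMeasurablePartition ξ) {p : X → Prop} (hp : ∀ᵐ x ∂μ, p x) :
    ∃ X₀ ⊆ X', MeasurableSet X₀ ∧ μ X₀ = 1 ∧ (∀ x ∈ X₀, κ x (atom ξ x ∩ X₀) = 1) ∧
      ∀ x ∈ X₀, p x := by
  obtain ⟨E₀, hE₀μ, hE₀m, hE₀p⟩ := hp.exists_measurable_mem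
  have hX'μ : X' ∈ ae μ := (mem_ae_iff_prob_eq_one h.measurableSet).2 h.measure_eq_one
  have hstep : ∀ E : Set X, ∃ E' : Set X, MeasurableSet E ∧ E ∈ ae μ →
      (MeasurableSet E' ∧ E' ∈ ae μ) ∧ E' ⊆ E ∧ ∀ x ∈ E', κ x E = 1 := by
    intro E
    by_cases hE : MeasurableSet E ∧ E ∈ ae μ
    · obtain ⟨F, hFμ, hFm, hF⟩ := (h.ae_apply_eq_one hE.1 hE.2).exists_measurable_mem
      exact ⟨E ∩ F, fun _ => ⟨⟨hE.1.inter hFm, inter_mem hE.2 hFμ⟩, Set.inter_subset_left,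
        fun x hx => hF x hx.2⟩⟩
    · exact ⟨∅, fun hE' => absurd hE' hE⟩
  choose f hf using hstep
  set Y : ℕ → Set X := fun n => f^[n] (X' ∩ E₀) with hY
  have hYs : ∀ n, Y (n + 1) = f (Y n) := fun n => Function.iterate_succ_apply' f n _
  have hYm : ∀ n, MeasurableSet (Y n) ∧ Y n ∈ ae μ := by
    intro n
    induction n with
    | zero => exact ⟨h.measurableSet.inter hE₀m, inter_mem hX'μ hE₀μ⟩
    | succ n ih =>
      rw [hYs]
      exact (hf _ ih).1
  have hYκ : ∀ n, ∀ x ∈ Y (n + 1), κ x (Y n) = 1 := fun n => by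
    rw [hYs]
    exact (hf _ (hYm n)).2.2
  have hm : MeasurableSet (⋂ n, Y n) := MeasurableSet.iInter fun n => (hYm n).1
  have hX₀ : (⋂ n, Y n) ⊆ X' ∩ E₀ := Set.iInter_subset Y 0
  refine ⟨⋂ n, Y n, fun x hx => (hX₀ hx).1, hm, ?_, fun x hx => ?_,
    fun x hx => hE₀p x (hX₀ hx).2⟩
  · exact (mem_ae_iff_prob_eq_one hm).1 (countable_iInter_mem.2 fun n => (hYm n).2)
  · have hxX' := (hX₀ hx).1
    have hprob := h.isProbabilityMeasure x hxX'
    have h1 : ∀ n, Y n ∈ ae (κ x) := fun n => (mem_ae_iff_prob_eq_one (hYm n).1).2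
      (hYκ n x (Set.mem_iInter.1 hx (n + 1)))
    have hatom := hξ.measurableSet_atom x
    have h2 : X' ∩ atom ξ x ∈ ae (κ x) :=
      (mem_ae_iff_prob_eq_one (h.measurableSet.inter hatom)).2 (h.measure_atom x hxX')
    refine (mem_ae_iff_prob_eq_one (hatom.inter hm)).1 ?_
    exact inter_mem (mem_of_superset h2 Set.inter_subset_right) (countable_iInter_mem.2 h1)

end Disintegration

end LocalSMB

theorem proposition3p1 {X : Type*} [MetricSpace X] [CompactSpace X] [MeasurableSpace X]
    [BorelSpace X] (T : X ≃ₜ X) (μ : Measure X) [IsProbabilityMeasure μ]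
    (hT : MeasurePreserving T μ μ)
    (ξ α : Setoid X) (hξ : LocalSMB.IsMeasurablePartition ξ)
    (hTξ : LocalSMB.Coarser (LocalSMB.translate T 1 ξ) ξ)
    (hα : LocalSMB.IsFinitePartition α)
    (hαξ : LocalSMB.Coarser (LocalSMB.past T α) ξ) :
    -- all the functions involved are integrable
    ((∀ N : ℕ, 1 ≤ N → Integrable
        (LocalSMB.info μ (LocalSMB.window T α 0 ((N : ℤ) - 1)) (LocalSMB.hat μ ξ)) μ) ∧
      Integrable (LocalSMB.info μ α (LocalSMB.tailAlgebra μ T α ξ)) μ) ∧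
    -- almost everywhere convergence
    (∀ᵐ x ∂μ, Tendsto
      (fun N : ℕ => (1 / (N : ℝ)) *
        LocalSMB.info μ (LocalSMB.window T α 0 ((N : ℤ) - 1)) (LocalSMB.hat μ ξ) x)
      atTop
      (𝓝 (LocalSMB.condE μ (MeasurableSpace.invariants T)
        (LocalSMB.info μ α (LocalSMB.tailAlgebra μ T α ξ)) x))) ∧
    -- convergence in `L^1`
    Tendsto
      (fun N : ℕ => eLpNorm (fun x => (1 / (N : ℝ)) *
          LocalSMB.info μ (LocalSMB.window T α 0 ((N : ℤ) - 1)) (LocalSMB.hat μ ξ) x -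
          LocalSMB.condE μ (MeasurableSpace.invariants T)
            (LocalSMB.info μ α (LocalSMB.tailAlgebra μ T α ξ)) x) 1 μ)
      atTop (𝓝 0) ∧
    -- the ergodic case, for every disintegration of `μ` over `ξ`
    (Ergodic T μ → ∀ (X' : Set X) (κ : X → Measure X), LocalSMB.IsDisintegration μ ξ X' κ →
      ∃ X₀ : Set X, X₀ ⊆ X' ∧ MeasurableSet X₀ ∧ μ X₀ = 1 ∧
        ∀ x ∈ X₀, κ x (LocalSMB.atom ξ x ∩ X₀) = 1 ∧
          ∀ y ∈ LocalSMB.atom ξ x ∩ X₀, Tendsto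
            (fun N : ℕ => -Real.log
              ((κ x).real (LocalSMB.atom (LocalSMB.window T α 0 ((N : ℤ) - 1)) y)) / (N : ℝ))
            atTop
            (𝓝 (LocalSMB.condEntropy μ α (LocalSMB.tailAlgebra μ T α ξ)))) := by
  rw [LocalSMB.coarser_iff_le] at hTξ hαξ
  have hwin : ∀ N : ℕ,
      LocalSMB.IsFinitePartition (LocalSMB.window T α 0 ((N : ℤ) - 1)) :=
    fun N => LocalSMB.isFinitePartition_window T hα N
  have hae := LocalSMB.ae_tendsto_info_window hT hξ hTξ hα hαξ
  refine ⟨⟨fun N _ => LocalSMB.integrable_info (hwin N) (LocalSMB.isNullClosed_hat ξ),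
    LocalSMB.integrable_info hα LocalSMB.isNullClosed_tailAlgebra⟩, hae,
    LocalSMB.tendsto_eLpNorm_info_window hT hξ hTξ hα hαξ, fun herg X' κ hκ => ?_⟩
  -- the conditional measure of the atom of the window is its conditional probability
  have hinfo : ∀ᵐ x ∂μ, ∀ N : ℕ,
      LocalSMB.info μ (LocalSMB.window T α 0 ((N : ℤ) - 1)) (LocalSMB.hat μ ξ) x =
        -Real.log ((κ x).real (LocalSMB.atom (LocalSMB.window T α 0 ((N : ℤ) - 1)) x)) := by
    refine ae_all_iff.2 fun N => (hwin N).ae_atom (μ := μ)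
      (p := fun A x => LocalSMB.info μ (LocalSMB.window T α 0 ((N : ℤ) - 1))
        (LocalSMB.hat μ ξ) x = -Real.log ((κ x).real A)) fun A hA => ?_
    filter_upwards [hκ.ae_condE_indicator ((hwin N).2 A hA)] with x hx hxA
    rw [LocalSMB.info_eq_neg_log, ← LocalSMB.eq_atom_of_mem_classes hA hxA, hx]
  have hlim : ∀ᵐ x ∂μ, Tendsto (fun N : ℕ => -Real.log
      ((κ x).real (LocalSMB.atom (LocalSMB.window T α 0 ((N : ℤ) - 1)) x)) / (N : ℝ)) atTop
      (𝓝 (LocalSMB.condEntropy μ α (LocalSMB.tailAlgebra μ T α ξ))) := by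
    filter_upwards [hae, hinfo,
      LocalSMB.condE_invariants_info_ae_eq_condEntropy (ξ := ξ) herg hα] with x h1 h2 h3
    rw [h3] at h1
    refine h1.congr fun N => ?_
    rw [h2, one_div_mul_eq_div]
  obtain ⟨X₀, hsub, hm, h1, hatom, hX₀⟩ := hκ.exists_measurableSet_full hξ hlim
  refine ⟨X₀, hsub, hm, h1, fun x hx => ⟨hatom x hx, fun y hy => ?_⟩⟩
  rw [hκ.eq_of_atom_eq x (hsub hx) y (hsub hy.2) (LocalSMB.atom_eq_of_mem hy.1).symm]
  exact hX₀ y hy.2
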